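/- Theorem (convergence of BLOCC). Let $\mathcal X\subseteq\mathbb R^{d_x}$, $\mathcal Y\subseteq\mathbb R^{d_y}$ be non-empty, closed and convex, and let $f,g:\mathbb R^{d_x}\times\mathbb R^{d_y}\to\mathbb R$, $g^c:\mathbb R^{d_x}\times\mathbb R^{d_y}\to\mathbb R^{d_c}$ be differentiable at the points of $\mathcal X\times\mathcal Y$. Assume: (1) on $\mathcal X\times\mathcal Y$ the maps $f,\nabla f,\nabla g,g^c,\nabla g^c$ are Lipschitz jointly in $(x,y)$ with constants $l_{f,0},l_{f,1}>0,l_{g,1},l_{g^c,0},l_{g^c,1}$, and $g$ is $l_{g_x,0}$-Lipschitz in $x$; (2) for every $x\in\mathcal X$, on $\mathcal Y$ the function $g(x,\cdot)$ is $\alpha_g$-strongly convex ($\alpha_g>0$) and each component of $g^c(x,\cdot)$ is convex; (3) $\mathcal Y(x)=\{y\in\mathcal Y: g^c(x,y)\le 0\}\neq\emptyset$ for every $x\in\mathcal X$. Let $v(x)=\min_{y\in\mathcal Y(x)}g(x,y)$ and, for $\gamma>l_{f,1}/\alpha_g$, $$L_g(\mu,y;x)=g(x,y)+\langle\mu,g^c(x,y)\rangle,\qquad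 L_F(\mu,y;x)=f(x,y)+\gamma\,(g(x,y)-v(x))+\langle\mu,g^c(x,y)\rangle,$$ $$F_\gamma(x)=\max_{\mu\in\mathbb R^{d_c}_+}\min_{y\in\mathcal Y}L_F(\mu,y;x).$$ For $x\in\mathcal X$ let $(\mu_g^*(x),y_g^*(x))$ and $(\mu_F^*(x),y_F^*(x))$ be the solutions of $\max_{\mu\in\mathbb R^{d_c}_+}\min_{y\in\mathcal Y}$ of $L_g(\cdot,\cdot;x)$ and $L_F(\cdot,\cdot;x)$. Assume further, for every $x\in\mathcal X$: (4) the linear independence constraint qualification holds at $y=y_g^*(x)$ and at $y=y_F^*(x)$: the gradients $\nabla_y g^c_i(x,y)$ of the active constraints are linearly independent modulo the linear span of the normal cone of $\mathcal Y$ at $y$ (if $\mathcal Y=\mathbb R^{d_y}$, or $y$ is interior to $\mathcal Y$: linearly independent); (5) $\|\mu_g^*(x)\|<B_g$ and $\|\mu_F^*(x)\|<B_F$, where $B_F\le\beta\gamma$. For arguments $(y_g,\mu_g),(y_F,\mu_F)$ put $$\mathsf G(x;y_g,\mu_g,y_F,\mu_F)=\nabla_xf(x,y_F)+\gamma\big(\nabla_xg(x,y_F)-\nabla_xg(x,y_g)-\langle\mu_g,\nabla_xg^c(x,y_g)\rangle\big)+\langle\mu_F,\nabla_xg^c(x,y_F)\rangle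 .$$ Then $F_\gamma$ is differentiable on $\mathcal X$ (relative to $\mathcal X$) with gradient $\nabla F_\gamma(x)=\mathsf G(x;y_g^*(x),\mu_g^*(x),y_F^*(x),\mu_F^*(x))$. Let $l_{F,1}$ be a Lipschitz constant of this gradient map on $\mathcal X$. Run BLOCC with a stepsize $0<\eta\le 1/l_{F,1}$: $x_0\in\mathcal X$, and for $t=0,\dots,T-1$ an inner solver returns $(y_{g,t},\mu_{g,t})$, $(y_{F,t},\mu_{F,t})$ with $y_{g,t},y_{F,t}\in\mathcal Y$ and $$\|(y_{g,t},\mu_{g,t})-(y_g^*(x_t),\mu_g^*(x_t))\|^2\le K_g\epsilon_g,\qquad \|(y_{F,t},\mu_{F,t})-(y_F^*(x_t),\mu_F^*(x_t))\|^2\le K_F\epsilon_F$$ with $\epsilon_g,\epsilon_F>0$, and $x_{t+1}=\mathrm{Proj}_{\mathcal X}\big(x_t-\eta\,\mathsf G(x_t;y_{g,t},\mu_{g,t},y_{F,t},\mu_{F,t})\big)$. Assume that the bilevel problem has a finite optimal value: $f(x_0,y_g^*(x_0))-\inf_{x\in\mathcal X}f(x,y_g^*(x))\le\Delta<\infty$.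 Then, with $G_\eta(x_t)=\eta^{-1}(x_{t+1}-x_t)$ and for all $T\ge1$, $$\frac1T\sum_{t=0}^{T-1}\|G_\eta(x_t)\|^2\le C\Big(\frac1{\eta T}+\gamma^2\epsilon_F+\gamma^2\epsilon_g\Big),$$ where $C$ depends only on $\alpha_g,B_g,\beta,K_g,K_F,\Delta$ and the Lipschitz constants in (1). In particular, for stepsizes $\eta\ge c/\gamma$ with $c>0$ (stepsizes of order $1/\gamma$), $$\frac1T\sum_{t=0}^{T-1}\|G_\eta(x_t)\|^2\le C\Big(\frac{\gamma}{cT}+\gamma^2\epsilon_F+\gamma^2\epsilon_g\Big)=O\big(\gamma T^{-1}+\gamma^2\epsilon_F+\gamma^2\epsilon_g\big).$$ -/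

import Mathlib

open scoped NNReal

noncomputable section

namespace BLOCC

/-- Euclidean space of dimension `n`. -/
abbrev Vec (n : ℕ) := EuclideanSpace ℝ (Fin n)

/-- The product of two Euclidean spaces, with the Euclidean norm of the pair. -/
abbrev Pair (m n : ℕ) := WithLp 2 (Vec m × Vec n)

/-- A curried function of `(x, y)` as a function on the Euclidean product space. -/
def joint {m n : ℕ} {α : Type*} (h : Vec m → Vec n → α) : Pair m n → α :=
  fun p => h p.fst p.snd

/-- Partial gradient in the first variable. -/
def gradX {m n : ℕ} (h : Vec m → Vec n → ℝ) (x : Vec m) (y : Vec n) : Vec m :=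
  gradient (fun u => h u y) x

/-- Partial gradient in the second variable. -/
def gradY {m n : ℕ} (h : Vec m → Vec n → ℝ) (x : Vec m) (y : Vec n) : Vec n :=
  gradient (fun w => h x w) y

/-- The nonnegative orthant. -/
def orthant (n : ℕ) : Set (Vec n) := {μ | ∀ i, 0 ≤ μ i}

/-- The normal cone of `S` at `y`. -/
def normalCone {n : ℕ} (S : Set (Vec n)) (y : Vec n) : Set (Vec n) :=
  {w | ∀ z ∈ S, inner ℝ w (z - y) ≤ 0}

/-- `p` is the Euclidean projection of `z` onto `S`. -/
def IsProj {n : ℕ} (S : Set (Vec n)) (z p : Vec n) : Prop :=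
  p ∈ S ∧ ∀ w ∈ S, ‖z - p‖ ≤ ‖z - w‖

/-- The dual function `D(μ) = min_{y ∈ S} L(μ, y)`. -/
def dualFun {n c : ℕ} (S : Set (Vec n)) (L : Vec c → Vec n → ℝ) (μ : Vec c) : ℝ :=
  sInf (L μ '' S)

/-- `(μ, y)` solves `max_{μ ≥ 0} min_{y ∈ S} L(μ, y)`: `μ` maximizes the dual function over the
nonnegative orthant, and `y` minimizes `L(μ, ·)` over `S`. -/
def IsMaxMinSol {n c : ℕ} (S : Set (Vec n)) (L : Vec c → Vec n → ℝ)
    (μ : Vec c) (y : Vec n) : Prop :=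
  μ ∈ orthant c ∧ y ∈ S ∧ IsMaxOn (dualFun S L) (orthant c) μ ∧ IsMinOn (L μ) S y

end BLOCC

/-- The data of a bilevel problem with coupled lower-level constraints: minimize `f x (y x)` over
`x ∈ X`, where `y x` minimizes `g x` over `{y ∈ Y | gc x y ≤ 0}`. -/
structure BLOCC.Problem (dx dy dc : ℕ) where
  X : Set (BLOCC.Vec dx)
  Y : Set (BLOCC.Vec dy)
  f : BLOCC.Vec dx → BLOCC.Vec dy → ℝ
  g : BLOCC.Vec dx → BLOCC.Vec dy → ℝ
  gc : BLOCC.Vec dx → BLOCC.Vec dy → BLOCC.Vec dc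

namespace BLOCC.Problem

variable {dx dy dc : ℕ} (P : BLOCC.Problem dx dy dc)

/-- The product `X × Y`. -/
def dom : Set (Pair dx dy) := {p | p.fst ∈ P.X ∧ p.snd ∈ P.Y}

/-- The lower-level feasible set `Y(x)`. -/
def feas (x : Vec dx) : Set (Vec dy) := {y ∈ P.Y | ∀ i, P.gc x y i ≤ 0}

/-- The lower-level value function `v(x)`. -/
def v (x : Vec dx) : ℝ := sInf (P.g x '' P.feas x)

/-- The lower-level Lagrangian `L_g(μ, y; x)`. -/
def Lg (x : Vec dx) (μ : Vec dc) (y : Vec dy) : ℝ :=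
  P.g x y + inner ℝ μ (P.gc x y)

/-- The penalized Lagrangian `L_F(μ, y; x)`. -/
def LF (γ : ℝ) (x : Vec dx) (μ : Vec dc) (y : Vec dy) : ℝ :=
  P.f x y + γ * (P.g x y - P.v x) + inner ℝ μ (P.gc x y)

/-- The penalty reformulation `F_γ(x) = max_{μ ≥ 0} min_{y ∈ Y} L_F(μ, y; x)`. -/
def F (γ : ℝ) (x : Vec dx) : ℝ := sSup (dualFun P.Y (P.LF γ x) '' orthant dc)

/-- `⟨μ, ∇_x gc(x, y)⟩`. -/
def gradXgc (x : Vec dx) (y : Vec dy) (μ : Vec dc) : Vec dx :=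
  ∑ i, μ i • gradX (fun u w => P.gc u w i) x y

/-- The first-order expression for `∇v(x)`, evaluated at a pair `(y, μ)`. -/
def estV (x : Vec dx) (y : Vec dy) (μ : Vec dc) : Vec dx :=
  gradX P.g x y + P.gradXgc x y μ

/-- The first-order expression for `∇F_γ(x)`, evaluated at pairs `(yg, μg)` and `(yF, μF)`. At the
exact max-min solutions it is the closed form of the gradient; at the outputs of the inner solver
it is the estimate `g_{F,t}`. -/
def estF (γ : ℝ) (x : Vec dx) (yg : Vec dy) (μg : Vec dc) (yF : Vec dy) (μF : Vec dc) : Vec dx :=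
  gradX P.f x yF + γ • (gradX P.g x yF - P.estV x yg μg) + P.gradXgc x yF μF

/-- Linear independence constraint qualification of `gc x ≤ 0`, `y ∈ Y` at the point `y`: the
`y`-gradients of the active constraints are linearly independent modulo the linear span of the
normal cone of `Y` at `y`. At interior points of `Y` (in particular if `Y` is the whole space) the
normal cone is `{0}` and this is linear independence of the active gradients. -/
def LICQAt (x : Vec dx) (y : Vec dy) : Prop :=
  ∀ a : Fin dc → ℝ, (∀ i, P.gc x y i ≠ 0 → a i = 0) →
    ∑ i, a i • gradY (fun u w => P.gc u w i) x y ∈ Submodule.span ℝ (normalCone P.Y y) →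
    a = 0

/-- Lipschitz continuity on `X × Y`, convexity in `y`, and domain feasibility. -/
structure Assumptions (lf0 lf1 lgx0 lg1 lgc0 lgc1 : ℝ≥0) (αg : ℝ) : Prop where
  f_diff : ∀ p ∈ P.dom, DifferentiableAt ℝ (joint P.f) p
  g_diff : ∀ p ∈ P.dom, DifferentiableAt ℝ (joint P.g) p
  gc_diff : ∀ p ∈ P.dom, DifferentiableAt ℝ (joint P.gc) p
  f_lip : LipschitzOnWith lf0 (joint P.f) P.dom
  grad_f_lip : LipschitzOnWith lf1 (gradient (joint P.f)) P.dom
  g_lip_x : ∀ y ∈ P.Y, LipschitzOnWith lgx0 (fun x => P.g x y) P.X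
  grad_g_lip : LipschitzOnWith lg1 (gradient (joint P.g)) P.dom
  gc_lip : LipschitzOnWith lgc0 (joint P.gc) P.dom
  deriv_gc_lip : LipschitzOnWith lgc1 (fderiv ℝ (joint P.gc)) P.dom
  g_strongConvex : ∀ x ∈ P.X, StrongConvexOn P.Y αg (P.g x)
  gc_convex : ∀ x ∈ P.X, ∀ i, ConvexOn ℝ P.Y (fun y => P.gc x y i)
  X_nonempty : P.X.Nonempty
  X_closed : IsClosed P.X
  X_convex : Convex ℝ P.X
  Y_nonempty : P.Y.Nonempty
  Y_closed : IsClosed P.Y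
  Y_convex : Convex ℝ P.Y
  feas_nonempty : ∀ x ∈ P.X, (P.feas x).Nonempty

/-- The first `T` iterations of the algorithm with stepsize `η`: from `x 0 ∈ X`, the inner solver
returns `(yg t, μg t)` and `(yF t, μF t)` with `yg t, yF t ∈ Y`, and `x (t + 1)` is the projected
step along the estimated gradient. -/
structure IsRun (γ η : ℝ) (T : ℕ) (x : ℕ → Vec dx) (yg : ℕ → Vec dy) (μg : ℕ → Vec dc)
    (yF : ℕ → Vec dy) (μF : ℕ → Vec dc) : Prop where
  init : x 0 ∈ P.X
  yg_mem : ∀ t < T, yg t ∈ P.Y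
  yF_mem : ∀ t < T, yF t ∈ P.Y
  step : ∀ t < T,
    IsProj P.X (x t - η • P.estF γ (x t) (yg t) (μg t) (yF t) (μF t)) (x (t + 1))

end BLOCC.Problem

/-- The averaged squared projected gradient `(1/T) ∑_{t<T} ‖G_η(x_t)‖²`, where
`G_η(x_t) = η⁻¹ (x_{t+1} - x_t)`. -/
def BLOCC.avgSqProjGrad {n : ℕ} (η : ℝ) (T : ℕ) (x : ℕ → BLOCC.Vec n) : ℝ :=
  (1 / (T : ℝ)) * ∑ t ∈ Finset.range T, ‖η⁻¹ • (x (t + 1) - x t)‖ ^ 2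

end

/-!
A max-min solution of a strongly convex Lagrangian is a saddle point (`IsMaxMinSol.isSaddle`), which
gives feasibility, complementary slackness and strong duality. Hence `v(x)` is the saddle value of
`L_g`, and `F_γ = v_γ - γ v`, where `v_γ` is the value function of the problem with lower-level
objective `f + γ g` (`Problem.penalized`, `Problem.Assumptions.F_eq`). This objective is strongly
convex with parameter `γ α_g - l_{f,1} > 0`, because a Lipschitz gradient makes `f` weakly convex.

Both value functions are differentiated by one argument. Strong convexity makes the primal solution
Hölder continuous in `x`; the constraint qualification makes the multiplier unique, so boundedness
makes it continuous. The saddle inequalities at `x` and `x'` enclose `v(x') - v(x)` between two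
increments of the Lagrangian in `x` alone, whose linear parts agree up to `o(‖x' - x‖)`
(`Problem.Assumptions.hasGradientWithinAt_v`).

The rate is that of inexact projected gradient descent on `F_γ` (`avgSqProjGrad_le`). The error of
the estimate enters only through its inner products with the steps `x_{t+1} - x_t`. These are feasible
directions, and only in feasible directions does the Lipschitz constant of `g^c` on `X × Y` bound its
derivative, as `X` may have empty interior (`Problem.Assumptions.abs_inner_estF_sub_le`).
The total decrease of `F_γ` is bounded independently of `γ`, since
`f(x, y_g(x)) - l_{f,0}² / (2 l_{f,1}) ≤ F_γ(x) ≤ f(x, y_g(x))`.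
-/

noncomputable section

namespace BLOCC

open Filter Topology Set

/-! ### Convex analysis -/

section ConvexAnalysis

variable {E : Type*} [NormedAddCommGroup E]

/-- Quadratic growth of a strongly convex function away from a minimizer. -/
theorem strongConvexOn_growth [NormedSpace ℝ E] {S : Set E} {α : ℝ} {φ : E → ℝ}
    (h : StrongConvexOn S α φ) {y z : E} (hy : y ∈ S) (hz : z ∈ S) (hmin : IsMinOn φ S y) :
    φ y + α / 2 * ‖z - y‖ ^ 2 ≤ φ z := by
  have key : ∀ t ∈ Ioo (0 : ℝ) 1, φ y + α / 2 * (1 - t) * ‖z - y‖ ^ 2 ≤ φ z := by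
    intro t ht
    have h1 := h.2 hz hy ht.1.le (sub_nonneg.2 ht.2.le) (by ring)
    have h2 : φ y ≤ φ (t • z + (1 - t) • y) :=
      hmin (h.1 hz hy ht.1.le (sub_nonneg.2 ht.2.le) (by ring))
    simp only [smul_eq_mul] at h1
    have h3 : t * (φ y + α / 2 * (1 - t) * ‖z - y‖ ^ 2) ≤ t * φ z := by linarith
    exact le_of_mul_le_mul_left h3 ht.1
  have hlim : Tendsto (fun t : ℝ => φ y + α / 2 * (1 - t) * ‖z - y‖ ^ 2) (𝓝[>] 0)
      (𝓝 (φ y + α / 2 * (1 - 0) * ‖z - y‖ ^ 2)) :=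
    ((by fun_prop : Continuous fun t : ℝ => φ y + α / 2 * (1 - t) * ‖z - y‖ ^ 2).tendsto
      0).mono_left nhdsWithin_le_nhds
  rw [sub_zero, mul_one] at hlim
  exact le_of_tendsto hlim (by filter_upwards [Ioo_mem_nhdsGT one_pos] with t ht using key t ht)

variable [InnerProductSpace ℝ E] [CompleteSpace E]

/-- The quadratic upper bound for a function whose gradient relative to a convex set is Lipschitz
there. The set may have empty interior. -/
theorem le_quadratic_of_lipschitz_gradient {S : Set E} (hS : Convex ℝ S) {φ : E → ℝ} {G : E → E}
    {l : ℝ≥0} (hφ : ∀ x ∈ S, HasGradientWithinAt φ (G x) S x) (hG : LipschitzOnWith l G S)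
    {y z : E} (hy : y ∈ S) (hz : z ∈ S) :
    φ z ≤ φ y + inner ℝ (G y) (z - y) + l / 2 * ‖z - y‖ ^ 2 := by
  set d := z - y with hd
  have hmem : ∀ t ∈ Icc (0 : ℝ) 1, y + t • d ∈ S := fun t ht =>
    hS.add_smul_sub_mem hy hz ht
  have hder : ∀ t ∈ Icc (0 : ℝ) 1, HasDerivWithinAt
      (fun t => φ (y + t • d) - t * inner ℝ (G y) d - l / 2 * t ^ 2 * ‖d‖ ^ 2)
      (inner ℝ (G (y + t • d)) d - inner ℝ (G y) d - l * t * ‖d‖ ^ 2) (Icc 0 1) t := by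
    intro t ht
    have h1 := (hφ _ (hmem t ht)).hasFDerivWithinAt
    have h2 : HasDerivWithinAt (fun t : ℝ => y + t • d) d (Icc 0 1) t := by
      simpa using ((hasDerivWithinAt_id t (Icc 0 1)).smul_const d).const_add y
    have h3 := h1.comp_hasDerivWithinAt t h2 hmem
    have h4 : HasDerivWithinAt (fun t : ℝ => t * inner ℝ (G y) d) (inner ℝ (G y) d) (Icc 0 1) t := by
      simpa using (hasDerivWithinAt_id t (Icc 0 1)).mul_const (inner ℝ (G y) d)
    have h5 : HasDerivWithinAt (fun t : ℝ => l / 2 * t ^ 2 * ‖d‖ ^ 2) (l * t * ‖d‖ ^ 2)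
        (Icc 0 1) t := by
      refine ((((hasDerivAt_pow 2 t).hasDerivWithinAt).const_mul (l / 2 : ℝ)).mul_const
        (‖d‖ ^ 2)).congr_deriv ?_
      push_cast
      ring
    exact (h3.sub h4).sub h5
  have hanti := antitoneOn_of_deriv_nonpos (convex_Icc (0 : ℝ) 1)
    (fun t ht => (hder t ht).continuousWithinAt)
    (fun t ht => ((hder t (interior_subset ht)).differentiableWithinAt).mono interior_subset)
    (fun t ht => by
      rw [((hder t (interior_subset ht)).hasDerivAt (mem_interior_iff_mem_nhds.1 ht)).deriv]
      have ht' := interior_subset ht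
      have h1 := hG.dist_le_mul _ (hmem t ht') _ hy
      rw [dist_eq_norm, dist_eq_norm, add_sub_cancel_left, norm_smul, Real.norm_of_nonneg ht'.1]
        at h1
      have h2 := real_inner_le_norm (G (y + t • d) - G y) d
      rw [inner_sub_left] at h2
      nlinarith [norm_nonneg d])
  have := hanti (left_mem_Icc.2 zero_le_one) (right_mem_Icc.2 zero_le_one) zero_le_one
  simp only [one_smul, zero_smul, add_zero, hd, add_sub_cancel] at this
  simp only [one_mul, zero_mul, one_pow, mul_one, sub_zero, ← hd] at this
  norm_num at this
  linarith

theorem quadratic_le_of_lipschitz_gradient {S : Set E} (hS : Convex ℝ S) {φ : E → ℝ} {G : E → E}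
    {l : ℝ≥0} (hφ : ∀ x ∈ S, HasGradientWithinAt φ (G x) S x) (hG : LipschitzOnWith l G S)
    {y z : E} (hy : y ∈ S) (hz : z ∈ S) :
    φ y + inner ℝ (G y) (z - y) - l / 2 * ‖z - y‖ ^ 2 ≤ φ z := by
  have := le_quadratic_of_lipschitz_gradient (φ := fun x => - φ x) (G := fun x => - G x) hS
    (fun x hx => by
      have h := (hφ x hx).hasFDerivWithinAt.neg
      rw [← map_neg] at h
      exact h) (l := l)
    (fun x hx y hy => by simpa [edist_neg_neg] using hG hx hy) hy hz
  rw [inner_neg_left] at this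
  linarith

end ConvexAnalysis

theorem IsProj.inner_nonpos {n : ℕ} {S : Set (Vec n)} (hS : Convex ℝ S) {z p w : Vec n}
    (h : IsProj S z p) (hw : w ∈ S) : inner ℝ (z - p) (w - p) ≤ 0 := by
  refine (norm_eq_iInf_iff_real_inner_le_zero hS h.1).1 (le_antisymm ?_ ?_) w hw
  · have : Nonempty S := ⟨⟨p, h.1⟩⟩
    exact le_ciInf fun w => h.2 w w.2
  · exact ciInf_le ⟨0, by rintro _ ⟨w, rfl⟩; exact norm_nonneg _⟩ (⟨p, h.1⟩ : S)

/-! ### Saddle points -/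

theorem mem_orthant_add_smul {c : ℕ} {μ μ' : Vec c} (hμ : μ ∈ orthant c) (hμ' : μ' ∈ orthant c)
    {t : ℝ} (ht : t ∈ Icc (0 : ℝ) 1) : μ + t • (μ' - μ) ∈ orthant c := by
  intro i
  have h1 := hμ i
  have h2 := hμ' i
  simp only [PiLp.add_apply, PiLp.smul_apply, PiLp.sub_apply, smul_eq_mul]
  nlinarith [ht.1, ht.2, mul_nonneg ht.1 h2, mul_nonneg (sub_nonneg.2 ht.2) h1]

theorem isClosed_orthant (c : ℕ) : IsClosed (orthant c) := by
  simp only [orthant, Set.ofPred_forall]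
  exact isClosed_iInter fun i => isClosed_le continuous_const (by fun_prop)

/-- A saddle point over the nonnegative orthant and `S` of the Lagrangian `L` with constraint
map `G`; optimality of the multiplier is expressed through the linear function
`μ' ↦ ⟨μ', G y⟩`. -/
structure IsSaddle {n c : ℕ} (S : Set (Vec n)) (L : Vec c → Vec n → ℝ) (G : Vec n → Vec c)
    (μ : Vec c) (y : Vec n) : Prop where
  mem_orthant : μ ∈ orthant c
  mem : y ∈ S
  inner_le : ∀ μ' ∈ orthant c, inner ℝ (μ' - μ) (G y) ≤ 0
  isMinOn : IsMinOn (L μ) S y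

theorem dualFun_eq_of_isMinOn {n c : ℕ} {S : Set (Vec n)} {L : Vec c → Vec n → ℝ}
    {μ : Vec c} {y : Vec n} (hy : y ∈ S) (h : IsMinOn (L μ) S y) : dualFun S L μ = L μ y :=
  IsLeast.csInf_eq ⟨⟨y, hy, rfl⟩, by rintro _ ⟨z, hz, rfl⟩; exact h hz⟩

/-- For a strongly convex Lagrangian a max-min solution is a saddle point. Strong convexity gives
`D(μ') ≥ D(μ) + ⟨μ' - μ, G y⟩ - l² ‖μ' - μ‖² / (2α)` for the dual function `D`, so the maximality
of `D(μ)` forces `⟨μ' - μ, G y⟩ ≤ 0`. -/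
theorem IsMaxMinSol.isSaddle {n c : ℕ} {S : Set (Vec n)} {L : Vec c → Vec n → ℝ}
    {G : Vec n → Vec c} {α : ℝ} {l : ℝ≥0} {μ : Vec c} {y : Vec n} (h : IsMaxMinSol S L μ y)
    (hα : 0 < α) (hL : StrongConvexOn S α (L μ)) (hG : LipschitzOnWith l G S)
    (hLG : ∀ μ' z, L μ' z = L μ z + inner ℝ (μ' - μ) (G z)) : IsSaddle S L G μ y := by
  obtain ⟨hμ, hy, hmax, hmin⟩ := h
  refine ⟨hμ, hy, fun μ' hμ' => ?_, hmin⟩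
  -- the lower bound on the dual function, compared with the maximality of its value at `μ`
  have low : ∀ ν ∈ orthant c,
      inner ℝ (ν - μ) (G y) ≤ l ^ 2 * ‖ν - μ‖ ^ 2 / (2 * α) := by
    intro ν hν
    have hlow : L μ y + inner ℝ (ν - μ) (G y) - l ^ 2 * ‖ν - μ‖ ^ 2 / (2 * α)
        ≤ dualFun S L ν := by
      refine le_csInf ⟨_, y, hy, rfl⟩ ?_
      rintro _ ⟨z, hz, rfl⟩
      rw [hLG ν z]
      have h1 := strongConvexOn_growth hL hy hz hmin
      have h2 : -(‖ν - μ‖ * (l * ‖z - y‖)) ≤ inner ℝ (ν - μ) (G z) - inner ℝ (ν - μ) (G y) := by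
        rw [← inner_sub_right]
        refine le_trans (neg_le_neg ?_) (neg_le_of_abs_le (abs_real_inner_le_norm _ _))
        gcongr
        simpa [dist_eq_norm] using hG.dist_le_mul _ hz _ hy
      have h3 : ‖ν - μ‖ * (l * ‖z - y‖) ≤
          α / 2 * ‖z - y‖ ^ 2 + l ^ 2 * ‖ν - μ‖ ^ 2 / (2 * α) := by
        have : 0 ≤ (α * ‖z - y‖ - l * ‖ν - μ‖) ^ 2 / (2 * α) := by positivity
        have e : (α * ‖z - y‖ - l * ‖ν - μ‖) ^ 2 / (2 * α) =
          α / 2 * ‖z - y‖ ^ 2 + l ^ 2 * ‖ν - μ‖ ^ 2 / (2 * α) - ‖ν - μ‖ * (l * ‖z - y‖) := by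
          field_simp; ring
        linarith
      linarith
    have h1 : dualFun S L ν ≤ dualFun S L μ := hmax hν
    rw [dualFun_eq_of_isMinOn hy hmin] at h1
    linarith
  set A := inner ℝ (μ' - μ) (G y)
  set K := l ^ 2 * ‖μ' - μ‖ ^ 2 / (2 * α)
  -- the bound `low` at `μ + t (μ' - μ)`, divided by `t`; then `t → 0`
  have key : ∀ t ∈ Ioo (0 : ℝ) 1, A ≤ t * K := by
    intro t ht
    have h1 := low _ (mem_orthant_add_smul hμ hμ' (Ioo_subset_Icc_self ht))
    rw [add_sub_cancel_left, real_inner_smul_left, norm_smul, Real.norm_of_nonneg ht.1.le] at h1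
    have h2 : t * A ≤ t * (t * K) := by
      refine h1.trans_eq ?_
      simp only [K]; ring
    exact le_of_mul_le_mul_left h2 ht.1
  have hlim : Tendsto (fun t : ℝ => t * K) (𝓝[>] 0) (𝓝 (0 * K)) :=
    ((by fun_prop : Continuous fun t : ℝ => t * K).tendsto 0).mono_left nhdsWithin_le_nhds
  rw [zero_mul] at hlim
  exact ge_of_tendsto hlim (by filter_upwards [Ioo_mem_nhdsGT one_pos] with t ht using key t ht)

namespace IsSaddle

variable {n c : ℕ} {S : Set (Vec n)} {L : Vec c → Vec n → ℝ} {G : Vec n → Vec c} {μ : Vec c}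
  {y : Vec n}

theorem apply_nonpos (h : IsSaddle S L G μ y) (i : Fin c) : G y i ≤ 0 := by
  have := h.inner_le (μ + EuclideanSpace.single i 1) (fun j => by
    have := h.mem_orthant j
    by_cases hj : j = i <;> simp [hj] <;> first | (subst hj; linarith) | linarith)
  rw [add_sub_cancel_left, EuclideanSpace.inner_single_left] at this
  simpa using this

theorem inner_nonpos (h : IsSaddle S L G μ y) {z : Vec n} (hz : ∀ i, G z i ≤ 0) :
    inner ℝ μ (G z) ≤ 0 := by
  rw [PiLp.inner_apply]
  refine Finset.sum_nonpos fun i _ => ?_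
  simpa [mul_comm] using mul_nonpos_of_nonneg_of_nonpos (h.mem_orthant i) (hz i)

/-- Complementary slackness. -/
theorem inner_eq_zero (h : IsSaddle S L G μ y) : inner ℝ μ (G y) = 0 := by
  refine le_antisymm (h.inner_nonpos h.apply_nonpos) ?_
  have := h.inner_le 0 (fun i => by simp)
  rw [zero_sub, inner_neg_left] at this
  linarith

theorem mul_eq_zero (h : IsSaddle S L G μ y) (i : Fin c) : μ i * G y i = 0 := by
  have h0 := h.inner_eq_zero
  rw [PiLp.inner_apply, Finset.sum_eq_zero_iff_of_nonpos] at h0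
  · simpa [mul_comm] using h0 i (Finset.mem_univ i)
  · intro j _
    simpa [mul_comm] using mul_nonpos_of_nonneg_of_nonpos (h.mem_orthant j) (h.apply_nonpos j)

end IsSaddle

/-! ### Partial gradients and joint derivatives -/

/-- The point `(x, y)` of the Euclidean product. -/
abbrev pt {m n : ℕ} (x : Vec m) (y : Vec n) : Pair m n := WithLp.toLp 2 (x, y)

theorem pt_sub_pt {m n : ℕ} (x x' : Vec m) (y y' : Vec n) :
    pt x' y' - pt x y = pt (x' - x) (y' - y) := rfl

theorem norm_pt_le {m n : ℕ} (x : Vec m) (y : Vec n) : ‖pt x y‖ ≤ ‖x‖ + ‖y‖ := by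
  have h : pt x y = pt x 0 + pt 0 y := by
    rw [← WithLp.toLp_add]; simp
  rw [h]
  refine (norm_add_le _ _).trans_eq ?_
  rw [WithLp.norm_toLp_fst, WithLp.norm_toLp_snd]

theorem norm_pt_zero_right {m n : ℕ} (x : Vec m) : ‖pt x (0 : Vec n)‖ = ‖x‖ :=
  WithLp.norm_toLp_fst ..

theorem norm_pt_zero_left {m n : ℕ} (y : Vec n) : ‖pt (0 : Vec m) y‖ = ‖y‖ :=
  WithLp.norm_toLp_snd ..

theorem hasFDerivAt_pt_left {m n : ℕ} (x : Vec m) (y : Vec n) :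
    HasFDerivAt (fun u => pt u y)
      ((WithLp.prodContinuousLinearEquiv 2 ℝ (Vec m) (Vec n)).symm.toContinuousLinearMap ∘L
        ContinuousLinearMap.inl ℝ (Vec m) (Vec n)) x :=
  (WithLp.prodContinuousLinearEquiv 2 ℝ (Vec m) (Vec n)).symm.toContinuousLinearMap.hasFDerivAt.comp
    x (hasFDerivAt_prodMk_left x y)

theorem hasFDerivAt_pt_right {m n : ℕ} (x : Vec m) (y : Vec n) :
    HasFDerivAt (fun w => pt x w)
      ((WithLp.prodContinuousLinearEquiv 2 ℝ (Vec m) (Vec n)).symm.toContinuousLinearMap ∘L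
        ContinuousLinearMap.inr ℝ (Vec m) (Vec n)) y :=
  (WithLp.prodContinuousLinearEquiv 2 ℝ (Vec m) (Vec n)).symm.toContinuousLinearMap.hasFDerivAt.comp
    y (hasFDerivAt_prodMk_right x y)

theorem inner_gradX {m n : ℕ} {h : Vec m → Vec n → ℝ} {x : Vec m} {y : Vec n}
    (hd : DifferentiableAt ℝ (joint h) (pt x y)) (d : Vec m) :
    inner ℝ (gradX h x y) d = fderiv ℝ (joint h) (pt x y) (pt d 0) := by
  have h1 : HasFDerivAt (fun u => h u y) _ x :=
    HasFDerivAt.comp (g := joint h) x hd.hasFDerivAt (hasFDerivAt_pt_left x y)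
  rw [gradX, inner_gradient_left, h1.fderiv]
  rfl

theorem inner_gradY {m n : ℕ} {h : Vec m → Vec n → ℝ} {x : Vec m} {y : Vec n}
    (hd : DifferentiableAt ℝ (joint h) (pt x y)) (w : Vec n) :
    inner ℝ (gradY h x y) w = fderiv ℝ (joint h) (pt x y) (pt 0 w) := by
  have h1 : HasFDerivAt (fun u => h x u) _ y :=
    HasFDerivAt.comp (g := joint h) y hd.hasFDerivAt (hasFDerivAt_pt_right x y)
  rw [gradY, inner_gradient_left, h1.fderiv]
  rfl

section

variable {E F : Type*} [NormedAddCommGroup E] [NormedSpace ℝ E] [NormedAddCommGroup F]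
  [NormedSpace ℝ F] {c : ℕ}

theorem fderiv_euclidean_apply {φ : E → Vec c} {p : E} (h : DifferentiableAt ℝ φ p) (i : Fin c)
    (q : E) : fderiv ℝ (fun p => φ p i) p q = fderiv ℝ φ p q i := by
  have h1 : HasFDerivAt (fun p => φ p i) _ p :=
    (EuclideanSpace.proj i : Vec c →L[ℝ] ℝ).hasFDerivAt.comp p h.hasFDerivAt
  rw [h1.fderiv]
  rfl

theorem differentiableAt_euclidean_apply {φ : E → Vec c} {p : E} (h : DifferentiableAt ℝ φ p)
    (i : Fin c) : DifferentiableAt ℝ (fun p => φ p i) p :=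
  (EuclideanSpace.proj i : Vec c →L[ℝ] ℝ).differentiableAt.comp p h

/-- Normed-space form of `DifferentiableAt.continuousAt`; on `Pair m n` it spares an expensive
unification of the topological-module instances. -/
theorem continuousAt_of_differentiableAt {φ : E → F} {p : E} (h : DifferentiableAt ℝ φ p) :
    ContinuousAt φ p :=
  h.continuousAt

end

theorem fderiv_joint_apply {m n c : ℕ} {G : Vec m → Vec n → Vec c} {p : Pair m n}
    (hd : DifferentiableAt ℝ (joint G) p) (i : Fin c) (q : Pair m n) :
    fderiv ℝ (joint fun u w => G u w i) p q = fderiv ℝ (joint G) p q i :=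
  fderiv_euclidean_apply hd i q

theorem differentiableAt_joint_apply {m n c : ℕ} {G : Vec m → Vec n → Vec c} {p : Pair m n}
    (hd : DifferentiableAt ℝ (joint G) p) (i : Fin c) :
    DifferentiableAt ℝ (joint fun u w => G u w i) p :=
  differentiableAt_euclidean_apply hd i

theorem tendsto_of_continuousAt_joint {m n : ℕ} {γ ι : Type*} [TopologicalSpace γ]
    {h : Vec m → Vec n → γ} {x : Vec m} {y : Vec n} (hc : ContinuousAt (joint h) (pt x y))
    {l : Filter ι} {u : ι → Vec m} {w : ι → Vec n} (hu : Tendsto u l (𝓝 x))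
    (hw : Tendsto w l (𝓝 y)) : Tendsto (fun i => h (u i) (w i)) l (𝓝 (h x y)) := by
  have h1 : Tendsto (fun i => pt (u i) (w i)) l (𝓝 (pt x y)) :=
    ((WithLp.prod_continuous_toLp 2 (Vec m) (Vec n)).tendsto _).comp (hu.prodMk_nhds hw)
  exact hc.tendsto.comp h1

namespace Problem

variable {dx dy dc : ℕ} {P : Problem dx dy dc}

theorem inner_gradXgc {x : Vec dx} {y : Vec dy} (hd : DifferentiableAt ℝ (joint P.gc) (pt x y))
    (μ : Vec dc) (d : Vec dx) :
    inner ℝ (P.gradXgc x y μ) d = inner ℝ μ (fderiv ℝ (joint P.gc) (pt x y) (pt d 0)) := by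
  rw [gradXgc, sum_inner, PiLp.inner_apply]
  refine Finset.sum_congr rfl fun i _ => ?_
  rw [real_inner_smul_left, inner_gradX (differentiableAt_joint_apply hd i),
    fderiv_joint_apply hd]
  simp [mul_comm]

theorem inner_sum_gradY {x : Vec dx} {y : Vec dy} (hd : DifferentiableAt ℝ (joint P.gc) (pt x y))
    (μ : Vec dc) (w : Vec dy) :
    inner ℝ (∑ i, μ i • gradY (fun u w => P.gc u w i) x y) w =
      inner ℝ μ (fderiv ℝ (joint P.gc) (pt x y) (pt 0 w)) := by
  rw [sum_inner, PiLp.inner_apply]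
  refine Finset.sum_congr rfl fun i _ => ?_
  rw [real_inner_smul_left, inner_gradY (differentiableAt_joint_apply hd i),
    fderiv_joint_apply hd]
  simp [mul_comm]

theorem mem_dom {x : Vec dx} {y : Vec dy} (hx : x ∈ P.X) (hy : y ∈ P.Y) : pt x y ∈ P.dom :=
  ⟨hx, hy⟩

variable (P) in
/-- The lower-level Lagrangian `L_g(μ, ·; ·)` as a function on the Euclidean product. -/
def lag (μ : Vec dc) (p : Pair dx dy) : ℝ := joint P.g p + inner ℝ μ (joint P.gc p)

variable (P) in
/-- The derivative of `Problem.lag` at points where `g` and `gc` are differentiable. -/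
def dLag (μ : Vec dc) (p : Pair dx dy) : Pair dx dy →L[ℝ] ℝ :=
  fderiv ℝ (joint P.g) p + (innerSL ℝ μ) ∘L fderiv ℝ (joint P.gc) p

theorem lag_pt (μ : Vec dc) (x : Vec dx) (y : Vec dy) : P.lag μ (pt x y) = P.Lg x μ y := rfl

theorem dLag_apply (μ : Vec dc) (p q : Pair dx dy) :
    P.dLag μ p q = fderiv ℝ (joint P.g) p q + inner ℝ μ (fderiv ℝ (joint P.gc) p q) := rfl

theorem Lg_eq_add_inner (x : Vec dx) (μ μ' : Vec dc) (y : Vec dy) :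
    P.Lg x μ' y = P.Lg x μ y + inner ℝ (μ' - μ) (P.gc x y) := by
  rw [Lg, Lg, inner_sub_left]; ring

theorem v_eq {x : Vec dx} {μ : Vec dc} {y : Vec dy}
    (h : IsSaddle P.Y (P.Lg x) (P.gc x) μ y) : P.v x = P.g x y := by
  refine IsLeast.csInf_eq ⟨⟨y, ⟨h.mem, h.apply_nonpos⟩, rfl⟩, ?_⟩
  rintro _ ⟨z, hz, rfl⟩
  have h1 : P.Lg x μ y ≤ P.Lg x μ z := h.isMinOn hz.1
  rw [Lg, Lg, h.inner_eq_zero] at h1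
  have h2 := h.inner_nonpos hz.2
  linarith

theorem v_eq_Lg {x : Vec dx} {μ : Vec dc} {y : Vec dy}
    (h : IsSaddle P.Y (P.Lg x) (P.gc x) μ y) : P.v x = P.Lg x μ y := by
  rw [v_eq h, Lg, h.inner_eq_zero, add_zero]

namespace Assumptions

variable {lf0 lf1 lgx0 lg1 lgc0 lgc1 : ℝ≥0} {α : ℝ}

theorem convex_dom (A : P.Assumptions lf0 lf1 lgx0 lg1 lgc0 lgc1 α) : Convex ℝ P.dom :=
  fun _ hp _ hq _ _ ha hb hab =>
    ⟨A.X_convex hp.1 hq.1 ha hb hab, A.Y_convex hp.2 hq.2 ha hb hab⟩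

theorem gc_lip_x (A : P.Assumptions lf0 lf1 lgx0 lg1 lgc0 lgc1 α) {x x' : Vec dx} {y : Vec dy}
    (hx : x ∈ P.X) (hx' : x' ∈ P.X) (hy : y ∈ P.Y) :
    ‖P.gc x' y - P.gc x y‖ ≤ lgc0 * ‖x' - x‖ := by
  have h := A.gc_lip.dist_le_mul _ (mem_dom hx' hy) _ (mem_dom hx hy)
  rwa [dist_eq_norm, dist_eq_norm, pt_sub_pt, sub_self, norm_pt_zero_right] at h

theorem gc_lip_y (A : P.Assumptions lf0 lf1 lgx0 lg1 lgc0 lgc1 α) {x : Vec dx} (hx : x ∈ P.X) :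
    LipschitzOnWith lgc0 (P.gc x) P.Y := by
  refine LipschitzOnWith.of_dist_le_mul fun y hy z hz => ?_
  have h := A.gc_lip.dist_le_mul _ (mem_dom hx hy) _ (mem_dom hx hz)
  rw [dist_eq_norm (pt x y), pt_sub_pt, sub_self, norm_pt_zero_left, ← dist_eq_norm] at h
  exact h

theorem strongConvexOn_Lg (A : P.Assumptions lf0 lf1 lgx0 lg1 lgc0 lgc1 α) {x : Vec dx}
    (hx : x ∈ P.X) {μ : Vec dc} (hμ : μ ∈ orthant dc) : StrongConvexOn P.Y α (P.Lg x μ) := by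
  have h1 : ConvexOn ℝ P.Y (fun y => inner ℝ μ (P.gc x y)) := by
    refine ⟨A.Y_convex, fun y hy z hz a b ha hb hab => ?_⟩
    simp only [PiLp.inner_apply, smul_eq_mul, Finset.mul_sum]
    rw [← Finset.sum_add_distrib]
    refine Finset.sum_le_sum fun i _ => ?_
    have := mul_le_mul_of_nonneg_left ((A.gc_convex x hx i).2 hy hz ha hb hab) (hμ i)
    simp only [smul_eq_mul] at this
    simp only [RCLike.inner_apply, conj_trivial]
    linarith
  have h2 := UniformConvexOn.add (A.g_strongConvex x hx) h1.uniformConvexOn_zero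
  rw [add_zero] at h2
  exact h2

theorem hasFDerivAt_lag (A : P.Assumptions lf0 lf1 lgx0 lg1 lgc0 lgc1 α) (μ : Vec dc)
    {p : Pair dx dy} (hp : p ∈ P.dom) : HasFDerivAt (P.lag μ) (P.dLag μ p) p :=
  (A.g_diff p hp).hasFDerivAt.add
    ((innerSL ℝ μ).hasFDerivAt.comp p (A.gc_diff p hp).hasFDerivAt)

theorem norm_dLag_sub_le (A : P.Assumptions lf0 lf1 lgx0 lg1 lgc0 lgc1 α) (μ : Vec dc)
    {p q : Pair dx dy} (hp : p ∈ P.dom) (hq : q ∈ P.dom) :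
    ‖P.dLag μ p - P.dLag μ q‖ ≤ (lg1 + ‖μ‖ * lgc1) * ‖p - q‖ := by
  have h1 : ‖fderiv ℝ (joint P.g) p - fderiv ℝ (joint P.g) q‖ ≤ lg1 * ‖p - q‖ := by
    rw [← toDual_gradient, ← toDual_gradient, ← map_sub, LinearIsometryEquiv.norm_map,
      ← dist_eq_norm, ← dist_eq_norm]
    exact A.grad_g_lip.dist_le_mul _ hp _ hq
  have h2 : ‖fderiv ℝ (joint P.gc) p - fderiv ℝ (joint P.gc) q‖ ≤ lgc1 * ‖p - q‖ := by
    rw [← dist_eq_norm, ← dist_eq_norm]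
    exact A.deriv_gc_lip.dist_le_mul _ hp _ hq
  have h3 : P.dLag μ p - P.dLag μ q = (fderiv ℝ (joint P.g) p - fderiv ℝ (joint P.g) q) +
      (innerSL ℝ μ) ∘L (fderiv ℝ (joint P.gc) p - fderiv ℝ (joint P.gc) q) := by
    rw [dLag, dLag, ContinuousLinearMap.comp_sub]; abel
  rw [h3]
  refine (norm_add_le _ _).trans ?_
  have h4 := (innerSL ℝ μ).opNorm_comp_le
    (fderiv ℝ (joint P.gc) p - fderiv ℝ (joint P.gc) q)
  rw [innerSL_apply_norm] at h4
  have h5 := mul_le_mul_of_nonneg_left h2 (norm_nonneg μ)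
  linarith

/-- First-order expansion of the Lagrangian between `a` and `b`, with the derivative taken at a nearby
point `p`. -/
theorem abs_lag_sub_sub_le (A : P.Assumptions lf0 lf1 lgx0 lg1 lgc0 lgc1 α) (μ : Vec dc)
    {a b p : Pair dx dy} {R : ℝ} (ha : a ∈ P.dom) (hb : b ∈ P.dom) (hp : p ∈ P.dom)
    (haR : ‖a - p‖ ≤ R) (hbR : ‖b - p‖ ≤ R) :
    |P.lag μ b - P.lag μ a - P.dLag μ p (b - a)| ≤
      (lg1 + ‖μ‖ * lgc1) * R * ‖b - a‖ := by
  refine (A.convex_dom.inter (convex_closedBall p R)).norm_image_sub_le_of_norm_hasFDerivWithin_le'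
    (f' := P.dLag μ) (fun q hq => (A.hasFDerivAt_lag μ hq.1).hasFDerivWithinAt) (fun q hq => ?_)
    ⟨ha, mem_closedBall_iff_norm.2 haR⟩ ⟨hb, mem_closedBall_iff_norm.2 hbR⟩
  refine (A.norm_dLag_sub_le μ hq.1 hp).trans ?_
  gcongr
  exact mem_closedBall_iff_norm.1 hq.2

theorem inner_estV (A : P.Assumptions lf0 lf1 lgx0 lg1 lgc0 lgc1 α) {x : Vec dx} {y : Vec dy}
    (hx : x ∈ P.X) (hy : y ∈ P.Y) (μ : Vec dc) (d : Vec dx) :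
    inner ℝ (P.estV x y μ) d = P.dLag μ (pt x y) (pt d 0) := by
  rw [estV, inner_add_left, inner_gradX (A.g_diff _ (mem_dom hx hy)),
    inner_gradXgc (A.gc_diff _ (mem_dom hx hy)), dLag_apply]

theorem abs_Lg_sub_le (A : P.Assumptions lf0 lf1 lgx0 lg1 lgc0 lgc1 α) {x x' : Vec dx}
    {y : Vec dy} (hx : x ∈ P.X) (hx' : x' ∈ P.X) (hy : y ∈ P.Y) (μ : Vec dc) :
    |P.Lg x' μ y - P.Lg x μ y| ≤ (lgx0 + ‖μ‖ * lgc0) * ‖x' - x‖ := by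
  have h1 := (A.g_lip_x y hy).dist_le_mul _ hx' _ hx
  rw [Real.dist_eq, dist_eq_norm] at h1
  have h2 := (abs_real_inner_le_norm μ (P.gc x' y - P.gc x y)).trans
    (mul_le_mul_of_nonneg_left (A.gc_lip_x hx hx' hy) (norm_nonneg μ))
  have h3 : P.Lg x' μ y - P.Lg x μ y =
      (P.g x' y - P.g x y) + inner ℝ μ (P.gc x' y - P.gc x y) := by
    rw [Lg, Lg, inner_sub_right]; ring
  rw [h3]
  refine (abs_add_le _ _).trans ?_
  linarith

/-! ### Continuity of the primal and dual solutions -/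

/-- The primal solutions are Hölder continuous of order `1/2`, with a constant that involves the
multipliers. -/
theorem mul_norm_sub_sq_le (A : P.Assumptions lf0 lf1 lgx0 lg1 lgc0 lgc1 α) {x x' : Vec dx}
    {μ μ' : Vec dc} {y y' : Vec dy} (hx : x ∈ P.X) (hx' : x' ∈ P.X)
    (h : IsSaddle P.Y (P.Lg x) (P.gc x) μ y) (h' : IsSaddle P.Y (P.Lg x') (P.gc x') μ' y') :
    α * ‖y' - y‖ ^ 2 ≤ (2 * lgx0 + (‖μ‖ + ‖μ'‖) * lgc0) * ‖x' - x‖ := by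
  have h1 := strongConvexOn_growth (A.strongConvexOn_Lg hx h.mem_orthant) h.mem h'.mem h.isMinOn
  have h2 := strongConvexOn_growth (A.strongConvexOn_Lg hx' h'.mem_orthant) h'.mem h.mem h'.isMinOn
  rw [norm_sub_rev] at h2
  have h3 := h.inner_le _ h'.mem_orthant
  have h4 := h'.inner_le _ h.mem_orthant
  have h5 := Lg_eq_add_inner (P := P) x μ μ' y
  have h6 := Lg_eq_add_inner (P := P) x' μ' μ y'
  have h7 := abs_le.1 (A.abs_Lg_sub_le hx hx' h'.mem μ)
  have h8 := abs_le.1 (A.abs_Lg_sub_le hx hx' h.mem μ')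
  linarith [h7.1, h8.2]

theorem tendsto_primal (A : P.Assumptions lf0 lf1 lgx0 lg1 lgc0 lgc1 α) (hα : 0 < α)
    {μ : Vec dx → Vec dc} {y : Vec dx → Vec dy} {B : ℝ}
    (hsol : ∀ x ∈ P.X, IsSaddle P.Y (P.Lg x) (P.gc x) (μ x) (y x))
    (hB : ∀ x ∈ P.X, ‖μ x‖ ≤ B) {x : Vec dx} (hx : x ∈ P.X) :
    Tendsto y (𝓝[P.X] x) (𝓝 (y x)) := by
  rw [tendsto_iff_norm_sub_tendsto_zero]
  have hlim : Tendsto (fun x' => √((2 * lgx0 + (B + B) * lgc0) * ‖x' - x‖ / α)) (𝓝[P.X] x)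
      (𝓝 √((2 * lgx0 + (B + B) * lgc0) * ‖x - x‖ / α)) := by
    refine Tendsto.mono_left (Continuous.tendsto ?_ x) nhdsWithin_le_nhds
    fun_prop
  rw [sub_self, norm_zero, mul_zero, zero_div, Real.sqrt_zero] at hlim
  refine squeeze_zero' (Eventually.of_forall fun _ => norm_nonneg _) ?_ hlim
  filter_upwards [self_mem_nhdsWithin] with x' hx'
  refine Real.le_sqrt_of_sq_le ?_
  rw [le_div_iff₀ hα, mul_comm]
  refine (A.mul_norm_sub_sq_le hx hx' (hsol x hx) (hsol x' hx')).trans ?_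
  gcongr
  exacts [hB x hx, hB x' hx']

/-- Under the constraint qualification the multiplier of a saddle point is unique: the difference
of two multipliers combines the active gradients into a difference of two normal vectors. -/
theorem multiplier_unique (A : P.Assumptions lf0 lf1 lgx0 lg1 lgc0 lgc1 α) {x : Vec dx}
    {μ μ' : Vec dc} {y : Vec dy} (hx : x ∈ P.X) (hL : P.LICQAt x y)
    (h : IsSaddle P.Y (P.Lg x) (P.gc x) μ y) (h' : IsSaddle P.Y (P.Lg x) (P.gc x) μ' y) :
    μ' = μ := by
  have hp := mem_dom hx h.mem
  -- stationarity of the Lagrangian over `Y`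
  have normal : ∀ ν, IsSaddle P.Y (P.Lg x) (P.gc x) ν y →
      -(gradY P.g x y + ∑ i, ν i • gradY (fun u w => P.gc u w i) x y) ∈ normalCone P.Y y := by
    intro ν hν z hz
    have h1 : HasFDerivAt (P.Lg x ν) _ y :=
      (A.hasFDerivAt_lag ν hp).comp y (hasFDerivAt_pt_right x y)
    have h2 := hν.isMinOn.localize.hasFDerivWithinAt_nonneg h1.hasFDerivWithinAt
      (sub_mem_posTangentConeAt_of_segment_subset (A.Y_convex.segment_subset h.mem hz))
    have h3 : 0 ≤ P.dLag ν (pt x y) (pt 0 (z - y)) := h2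
    rw [dLag_apply, ← inner_gradY (A.g_diff _ hp), ← inner_sum_gradY (A.gc_diff _ hp)] at h3
    rw [inner_neg_left, inner_add_left]
    linarith
  have key := hL (fun i => μ' i - μ i) (fun i hi => ?_) ?_
  · ext i
    exact sub_eq_zero.1 (congrFun key i)
  · have h1 := (mul_eq_zero.1 (h.mul_eq_zero i)).resolve_right hi
    have h2 := (mul_eq_zero.1 (h'.mul_eq_zero i)).resolve_right hi
    simp [h1, h2]
  · have h1 := Submodule.sub_mem _ (Submodule.subset_span (R := ℝ) (normal μ h))
      (Submodule.subset_span (R := ℝ) (normal μ' h'))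
    convert h1 using 1
    simp only [sub_smul, Finset.sum_sub_distrib]
    abel

/-- The multipliers depend continuously on `x`: a cluster point of bounded multipliers is a multiplier
at the limit, where it is unique by the constraint qualification. -/
theorem tendsto_multiplier (A : P.Assumptions lf0 lf1 lgx0 lg1 lgc0 lgc1 α) (hα : 0 < α)
    {μ : Vec dx → Vec dc} {y : Vec dx → Vec dy} {B : ℝ}
    (hsol : ∀ x ∈ P.X, IsSaddle P.Y (P.Lg x) (P.gc x) (μ x) (y x))
    (hB : ∀ x ∈ P.X, ‖μ x‖ ≤ B) {x : Vec dx} (hx : x ∈ P.X) (hL : P.LICQAt x (y x)) :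
    Tendsto μ (𝓝[P.X] x) (𝓝 (μ x)) := by
  refine (isCompact_closedBall (0 : Vec dc) B).tendsto_nhds_of_unique_mapClusterPt ?_ ?_
  · filter_upwards [self_mem_nhdsWithin] with x' hx'
    simpa using hB x' hx'
  · intro ν _ hν
    obtain ⟨U, hU, hνU⟩ := mapClusterPt_iff_ultrafilter.1 hν
    have hXU : ∀ᶠ x' in (U : Filter (Vec dx)), x' ∈ P.X := hU self_mem_nhdsWithin
    have hyU := (A.tendsto_primal hα hsol hB hx).mono_left hU
    have hxU : Tendsto (fun x' : Vec dx => x') U (𝓝 x) := fun s hs =>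
      hU (mem_nhdsWithin_of_mem_nhds hs)
    have hg : ∀ {w : Vec dx → Vec dy} {w₀ : Vec dy}, w₀ ∈ P.Y → Tendsto w U (𝓝 w₀) →
        Tendsto (fun x' => P.g x' (w x')) U (𝓝 (P.g x w₀)) := fun hw₀ hw =>
      tendsto_of_continuousAt_joint
        (continuousAt_of_differentiableAt (A.g_diff _ (mem_dom hx hw₀))) hxU hw
    have hgc : ∀ {w : Vec dx → Vec dy} {w₀ : Vec dy}, w₀ ∈ P.Y → Tendsto w U (𝓝 w₀) →
        Tendsto (fun x' => P.gc x' (w x')) U (𝓝 (P.gc x w₀)) := fun hw₀ hw =>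
      tendsto_of_continuousAt_joint
        (continuousAt_of_differentiableAt (A.gc_diff _ (mem_dom hx hw₀))) hxU hw
    have hy := (hsol x hx).mem
    refine A.multiplier_unique hx hL (hsol x hx) ⟨?_, hy, fun ν' hν' => ?_, fun z hz => ?_⟩
    · exact (isClosed_orthant dc).mem_of_tendsto hνU
        (hXU.mono fun x' hx' => (hsol x' hx').mem_orthant)
    · exact le_of_tendsto ((tendsto_const_nhds.sub hνU).inner (hgc hy hyU))
        (hXU.mono fun x' hx' => (hsol x' hx').inner_le ν' hν')
    · exact le_of_tendsto_of_tendsto ((hg hy hyU).add (hνU.inner (hgc hy hyU)))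
        ((hg hz tendsto_const_nhds).add (hνU.inner (hgc hz tendsto_const_nhds)))
        (hXU.mono fun x' hx' => (hsol x' hx').isMinOn hz)

/-! ### Differentiability of the value function -/

/-- The value function has gradient `∇_x L_g(μ(x), y(x); x)` relative to `X`. By the saddle
inequalities, `v x' - v x` lies between `L(μ, y'; x') - L(μ, y'; x)` and
`L(μ', y; x') - L(μ', y; x)`. -/
theorem hasGradientWithinAt_v (A : P.Assumptions lf0 lf1 lgx0 lg1 lgc0 lgc1 α) (hα : 0 < α)
    {μ : Vec dx → Vec dc} {y : Vec dx → Vec dy} {B : ℝ}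
    (hsol : ∀ x ∈ P.X, IsSaddle P.Y (P.Lg x) (P.gc x) (μ x) (y x))
    (hB : ∀ x ∈ P.X, ‖μ x‖ ≤ B) {x : Vec dx} (hx : x ∈ P.X) (hL : P.LICQAt x (y x)) :
    HasGradientWithinAt P.v (P.estV x (y x) (μ x)) P.X x := by
  have hy := A.tendsto_primal hα hsol hB hx
  have hμ := A.tendsto_multiplier hα hsol hB hx hL
  set D := ‖fderiv ℝ (joint P.gc) (pt x (y x))‖
  -- the modulus by which the remainder is bounded, divided by `‖x' - x‖`
  have hω : Tendsto (fun x' => (lg1 + B * lgc1) * (‖x' - x‖ + ‖y x' - y x‖) +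
      ‖μ x' - μ x‖ * D) (𝓝[P.X] x)
      (𝓝 ((lg1 + B * lgc1) * (‖x - x‖ + ‖y x - y x‖) + ‖μ x - μ x‖ * D)) := by
    have hx' : Tendsto (fun x' : Vec dx => x') (𝓝[P.X] x) (𝓝 x) := nhdsWithin_le_nhds
    exact (((hx'.sub_const x).norm.add (hy.sub_const _).norm).const_mul _).add
      ((hμ.sub_const _).norm.mul_const _)
  simp only [sub_self, norm_zero, add_zero, mul_zero, zero_mul] at hω
  rw [hasGradientWithinAt_iff_isLittleO, Asymptotics.isLittleO_iff]
  intro ε hε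
  filter_upwards [hω.eventually (gt_mem_nhds hε), self_mem_nhdsWithin] with x' hlt hx'
  have s := hsol x hx
  have s' := hsol x' hx'
  rw [A.inner_estV hx s.mem, v_eq_Lg s, v_eq_Lg s']
  refine le_trans ?_ (mul_le_mul_of_nonneg_right hlt.le (norm_nonneg _))
  have hM : ∀ z ∈ P.X, (lg1 + ‖μ z‖ * lgc1 : ℝ) ≤ lg1 + B * lgc1 := fun z hz => by
    gcongr; exact hB z hz
  have hM0 : (0 : ℝ) ≤ lg1 + B * lgc1 := le_trans (by positivity) (hM x hx)
  have lower := A.abs_lag_sub_sub_le (μ x) (mem_dom hx s'.mem) (mem_dom hx' s'.mem)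
    (mem_dom hx s.mem) (R := ‖x' - x‖ + ‖y x' - y x‖)
    ((norm_pt_le _ _).trans (by simp)) (norm_pt_le _ _)
  have upper := A.abs_lag_sub_sub_le (μ x') (mem_dom hx s.mem) (mem_dom hx' s.mem)
    (mem_dom hx s.mem) (R := ‖x' - x‖ + ‖y x' - y x‖)
    ((norm_pt_le _ _).trans (by simp; positivity)) ((norm_pt_le _ _).trans (by simp))
  simp only [pt_sub_pt, sub_self, norm_pt_zero_right, lag_pt] at lower upper
  have lowerM := mul_le_mul_of_nonneg_right (mul_le_mul_of_nonneg_right (hM x hx)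
    (by positivity : 0 ≤ ‖x' - x‖ + ‖y x' - y x‖)) (norm_nonneg (x' - x))
  have upperM := mul_le_mul_of_nonneg_right (mul_le_mul_of_nonneg_right (hM x' hx')
    (by positivity : 0 ≤ ‖x' - x‖ + ‖y x' - y x‖)) (norm_nonneg (x' - x))
  have hmul : |P.dLag (μ x') (pt x (y x)) (pt (x' - x) 0) -
      P.dLag (μ x) (pt x (y x)) (pt (x' - x) 0)| ≤ ‖μ x' - μ x‖ * D * ‖x' - x‖ := by
    rw [dLag_apply, dLag_apply, add_sub_add_left_eq_sub, ← inner_sub_left, mul_assoc]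
    refine (abs_real_inner_le_norm _ _).trans ?_
    gcongr
    refine (ContinuousLinearMap.le_opNorm _ _).trans_eq ?_
    rw [norm_pt_zero_right]
  -- the two saddle inequalities at `x` and at `x'`
  have i1 : P.Lg x (μ x) (y x) ≤ P.Lg x (μ x) (y x') := s.isMinOn s'.mem
  have i2 : P.Lg x' (μ x') (y x') ≤ P.Lg x' (μ x') (y x) := s'.isMinOn s.mem
  have i3 := s.inner_le _ s'.mem_orthant
  have i4 := s'.inner_le _ s.mem_orthant
  have e3 := Lg_eq_add_inner (P := P) x (μ x) (μ x') (y x)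
  have e4 := Lg_eq_add_inner (P := P) x' (μ x') (μ x) (y x')
  have p1 : 0 ≤ ‖μ x' - μ x‖ * D * ‖x' - x‖ := by positivity
  rw [Real.norm_eq_abs, abs_le, add_mul]
  obtain ⟨lower, -⟩ := abs_le.1 lower
  obtain ⟨-, upper⟩ := abs_le.1 upper
  obtain ⟨-, hmul⟩ := abs_le.1 hmul
  constructor <;> linarith

end Assumptions

end Problem

/-! ### The penalized problem -/

section

variable {E : Type*} [NormedAddCommGroup E] [InnerProductSpace ℝ E] [CompleteSpace E]

/-- A function whose gradient is `l`-Lipschitz on a convex set is weakly convex there with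
parameter `l`. -/
theorem strongConvexOn_neg_of_lipschitz_gradient {S : Set E} (hS : Convex ℝ S) {φ : E → ℝ}
    {G : E → E} {l : ℝ≥0} (hφ : ∀ x ∈ S, HasGradientWithinAt φ (G x) S x)
    (hG : LipschitzOnWith l G S) : StrongConvexOn S (-l) φ := by
  refine ⟨hS, fun y hy z hz a b ha hb hab => ?_⟩
  have hw := hS hy hz ha hb hab
  have h1 := mul_le_mul_of_nonneg_left (quadratic_le_of_lipschitz_gradient hS hφ hG hw hy) ha
  have h2 := mul_le_mul_of_nonneg_left (quadratic_le_of_lipschitz_gradient hS hφ hG hw hz) hb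
  have e1 : y - (a • y + b • z) = b • (y - z) := by
    rw [show a = 1 - b by linarith]; module
  have e2 : z - (a • y + b • z) = (-a) • (y - z) := by
    rw [show b = 1 - a by linarith]; module
  rw [e1, real_inner_smul_right, norm_smul, mul_pow, Real.norm_eq_abs, sq_abs] at h1
  rw [e2, real_inner_smul_right, norm_smul, mul_pow, Real.norm_eq_abs, sq_abs] at h2
  simp only [smul_eq_mul]
  set w := φ (a • y + b • z)
  set N := ‖y - z‖ ^ 2
  have e3 : a * w + b * w = w := by rw [← add_mul, hab, one_mul]
  have e4 : a * b * (-l / 2 * N) =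
      -(a * (l / 2 * (b ^ 2 * N)) + b * (l / 2 * ((-a) ^ 2 * N))) := by
    linear_combination (l / 2 * N * a * b) * hab
  nlinarith

theorem hasGradientAt_add_const_mul {φ ψ : E → ℝ} {p : E} (hφ : DifferentiableAt ℝ φ p)
    (hψ : DifferentiableAt ℝ ψ p) (γ : ℝ) :
    HasGradientAt (fun q => φ q + γ * ψ q) (gradient φ p + γ • gradient ψ p) p := by
  rw [hasGradientAt_iff_hasFDerivAt, map_add, map_smul, toDual_gradient, toDual_gradient]
  exact hφ.hasFDerivAt.add (hψ.hasFDerivAt.const_mul γ)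

end

/-- The derivative of a `K`-Lipschitz function is bounded by `K` along the directions that point into
the set, even where the set has empty interior. -/
theorem norm_fderiv_sub_le_of_lipschitzOnWith {E F : Type*} [NormedAddCommGroup E]
    [NormedSpace ℝ E] [NormedAddCommGroup F] [NormedSpace ℝ F] {S : Set E}
    (hS : Convex ℝ S) {φ : E → F} {K : ℝ≥0} (hφ : LipschitzOnWith K φ S) {a b : E} (ha : a ∈ S) (hb : b ∈ S)
    (hd : DifferentiableAt ℝ φ a) : ‖fderiv ℝ φ a (b - a)‖ ≤ K * ‖b - a‖ := by
  have h1 : HasDerivAt (fun t : ℝ => a + t • (b - a)) (b - a) 0 := by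
    simpa using ((hasDerivAt_id (0 : ℝ)).smul_const (b - a)).const_add a
  have h2 : HasDerivAt (fun t : ℝ => φ (a + t • (b - a))) (fderiv ℝ φ a (b - a)) 0 :=
    HasFDerivAt.comp_hasDerivAt (l := φ) 0 (by simpa using hd.hasFDerivAt) h1
  refine le_of_tendsto h2.tendsto_slope_zero_right.norm ?_
  filter_upwards [Ioo_mem_nhdsGT one_pos] with t ht
  have h3 := hφ.dist_le_mul _ (hS.add_smul_sub_mem ha hb (Ioo_subset_Icc_self ht)) _ ha
  rw [dist_eq_norm, dist_eq_norm, add_sub_cancel_left, norm_smul, Real.norm_of_nonneg ht.1.le]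
    at h3
  simp only [zero_add, zero_smul, add_zero]
  rw [norm_smul, norm_inv, Real.norm_of_nonneg ht.1.le, inv_mul_le_iff₀ ht.1]
  linarith

namespace Problem

variable {dx dy dc : ℕ} {P : Problem dx dy dc}

variable (P) in
/-- The problem with lower-level objective `f + γ g`. Its Lagrangian is that of the penalty
reformulation up to the term `γ v(x)`, so that `F_γ` is its value function minus `γ v`. -/
def penalized (γ : ℝ) : Problem dx dy dc where
  X := P.X
  Y := P.Y
  f := P.f
  g := fun x y => P.f x y + γ * P.g x y
  gc := P.gc

theorem LF_eq (γ : ℝ) (x : Vec dx) (μ : Vec dc) (y : Vec dy) :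
    P.LF γ x μ y = (P.penalized γ).Lg x μ y - γ * P.v x := by
  simp only [LF, Lg, penalized]; ring

namespace Assumptions

variable {lf0 lf1 lgx0 lg1 lgc0 lgc1 : ℝ≥0} {α γ : ℝ}

theorem weakConvexOn_f (A : P.Assumptions lf0 lf1 lgx0 lg1 lgc0 lgc1 α) {x : Vec dx}
    (hx : x ∈ P.X) : StrongConvexOn P.Y (-lf1) (P.f x) := by
  have h := strongConvexOn_neg_of_lipschitz_gradient A.convex_dom
    (fun p hp => (A.f_diff p hp).hasGradientAt.hasFDerivAt.hasFDerivWithinAt) A.grad_f_lip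
  refine ⟨A.Y_convex, fun y hy z hz a b ha hb hab => ?_⟩
  have h1 := h.2 (mem_dom hx hy) (mem_dom hx hz) ha hb hab
  have e : a • pt x y + b • pt x z = pt x (a • y + b • z) := by
    rw [← WithLp.toLp_smul, ← WithLp.toLp_smul, ← WithLp.toLp_add, Prod.smul_mk, Prod.smul_mk,
      Prod.mk_add_mk, ← add_smul, hab, one_smul]
  rw [e, pt_sub_pt, sub_self, norm_pt_zero_left] at h1
  exact h1

theorem penalized (A : P.Assumptions lf0 lf1 lgx0 lg1 lgc0 lgc1 α) (hγ : 0 ≤ γ) :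
    (P.penalized γ).Assumptions lf0 lf1 (lf0 + γ.toNNReal * lgx0) (lf1 + γ.toNNReal * lg1)
      lgc0 lgc1 (γ * α - lf1) where
  f_diff := A.f_diff
  g_diff p hp :=
    (hasGradientAt_add_const_mul (A.f_diff p hp) (A.g_diff p hp) γ).differentiableAt
  gc_diff := A.gc_diff
  f_lip := A.f_lip
  grad_f_lip := A.grad_f_lip
  g_lip_x y hy := by
    refine LipschitzOnWith.of_dist_le_mul fun x hx x' hx' => ?_
    have h1 := A.f_lip.dist_le_mul _ (mem_dom hx hy) _ (mem_dom hx' hy)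
    rw [dist_eq_norm (pt x y), pt_sub_pt, sub_self, norm_pt_zero_right] at h1
    have h2 := mul_le_mul_of_nonneg_left ((A.g_lip_x y hy).dist_le_mul _ hx _ hx') hγ
    rw [Real.dist_eq, dist_eq_norm, ← abs_of_nonneg hγ, ← abs_mul, abs_of_nonneg hγ] at h2
    change |P.f x y - P.f x' y| ≤ _ at h1
    change |(P.f x y + γ * P.g x y) - (P.f x' y + γ * P.g x' y)| ≤ _
    rw [dist_eq_norm]
    have e : (P.f x y + γ * P.g x y) - (P.f x' y + γ * P.g x' y) =
      (P.f x y - P.f x' y) + γ * (P.g x y - P.g x' y) := by ring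
    rw [e]
    refine (abs_add_le _ _).trans ?_
    push_cast
    rw [Real.coe_toNNReal _ hγ]
    linarith
  grad_g_lip := by
    have hg : ∀ p ∈ P.dom, gradient (joint (P.penalized γ).g) p =
        gradient (joint P.f) p + γ • gradient (joint P.g) p := fun p hp =>
      (hasGradientAt_add_const_mul (A.f_diff p hp) (A.g_diff p hp) γ).gradient
    refine LipschitzOnWith.of_dist_le_mul fun p hp q hq => ?_
    rw [hg p hp, hg q hq, dist_eq_norm]
    have e : (gradient (joint P.f) p + γ • gradient (joint P.g) p) -
        (gradient (joint P.f) q + γ • gradient (joint P.g) q) =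
        (gradient (joint P.f) p - gradient (joint P.f) q) +
          γ • (gradient (joint P.g) p - gradient (joint P.g) q) := by module
    rw [e]
    refine (norm_add_le _ _).trans ?_
    rw [norm_smul, Real.norm_of_nonneg hγ, ← dist_eq_norm, ← dist_eq_norm]
    have h1 := A.grad_f_lip.dist_le_mul _ hp _ hq
    have h2 := mul_le_mul_of_nonneg_left (A.grad_g_lip.dist_le_mul _ hp _ hq) hγ
    push_cast
    rw [Real.coe_toNNReal _ hγ]
    linarith
  gc_lip := A.gc_lip
  deriv_gc_lip := A.deriv_gc_lip
  g_strongConvex x hx := by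
    refine ⟨A.Y_convex, fun y hy z hz a b ha hb hab => ?_⟩
    have h1 := (A.weakConvexOn_f hx).2 hy hz ha hb hab
    have h2 := mul_le_mul_of_nonneg_left ((A.g_strongConvex x hx).2 hy hz ha hb hab) hγ
    simp only [smul_eq_mul, Problem.penalized] at h1 h2 ⊢
    linarith
  gc_convex := A.gc_convex
  X_nonempty := A.X_nonempty
  X_closed := A.X_closed
  X_convex := A.X_convex
  Y_nonempty := A.Y_nonempty
  Y_closed := A.Y_closed
  Y_convex := A.Y_convex
  feas_nonempty := A.feas_nonempty

theorem isSaddle_Lg (A : P.Assumptions lf0 lf1 lgx0 lg1 lgc0 lgc1 α) (hα : 0 < α) {x : Vec dx}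
    (hx : x ∈ P.X) {μ : Vec dc} {y : Vec dy} (h : IsMaxMinSol P.Y (P.Lg x) μ y) :
    IsSaddle P.Y (P.Lg x) (P.gc x) μ y :=
  h.isSaddle hα (A.strongConvexOn_Lg hx h.1) (A.gc_lip_y hx) fun _ _ => Lg_eq_add_inner ..

theorem isSaddle_penalized (A : P.Assumptions lf0 lf1 lgx0 lg1 lgc0 lgc1 α) (hγ : 0 ≤ γ)
    (hγα : lf1 < γ * α) {x : Vec dx} (hx : x ∈ P.X) {μ : Vec dc} {y : Vec dy}
    (h : IsMaxMinSol P.Y (P.LF γ x) μ y) :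
    IsSaddle P.Y ((P.penalized γ).Lg x) (P.gc x) μ y := by
  have h1 : IsSaddle P.Y (P.LF γ x) (P.gc x) μ y := by
    refine h.isSaddle (sub_pos.2 hγα) ?_ (A.gc_lip_y hx) fun μ' z => ?_
    · have h2 := (A.penalized hγ).strongConvexOn_Lg hx h.1
      refine ⟨h2.1, fun y hy z hz a b ha hb hab => ?_⟩
      have h3 := h2.2 hy hz ha hb hab
      simp only [LF_eq, smul_eq_mul] at h3 ⊢
      have e : a * (γ * P.v x) + b * (γ * P.v x) = γ * P.v x := by rw [← add_mul, hab, one_mul]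
      linarith
    · rw [LF_eq, LF_eq, Lg_eq_add_inner x μ μ']
      change _ + inner ℝ (μ' - μ) (P.gc x z) - _ = _
      ring
  refine ⟨h1.mem_orthant, h1.mem, h1.inner_le, fun z hz => ?_⟩
  have h2 : P.LF γ x μ y ≤ P.LF γ x μ z := h1.isMinOn hz
  rw [LF_eq, LF_eq] at h2
  exact (sub_le_sub_iff_right _).1 h2

theorem F_eq (A : P.Assumptions lf0 lf1 lgx0 lg1 lgc0 lgc1 α) (hγ : 0 ≤ γ)
    (hγα : lf1 < γ * α) {x : Vec dx} (hx : x ∈ P.X) {μ : Vec dc} {y : Vec dy}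
    (h : IsMaxMinSol P.Y (P.LF γ x) μ y) :
    P.F γ x = (P.penalized γ).v x - γ * P.v x := by
  have h1 : P.F γ x = dualFun P.Y (P.LF γ x) μ :=
    IsGreatest.csSup_eq ⟨⟨μ, h.1, rfl⟩, by rintro _ ⟨ν, hν, rfl⟩; exact h.2.2.1 hν⟩
  rw [h1, dualFun_eq_of_isMinOn h.2.1 h.2.2.2, LF_eq,
    v_eq_Lg (P := P.penalized γ) (A.isSaddle_penalized hγ hγα hx h)]

theorem estF_eq (A : P.Assumptions lf0 lf1 lgx0 lg1 lgc0 lgc1 α) (γ : ℝ) {x : Vec dx}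
    {yF : Vec dy} (hx : x ∈ P.X) (hyF : yF ∈ P.Y) (yg : Vec dy) (μg μF : Vec dc) :
    P.estF γ x yg μg yF μF = (P.penalized γ).estV x yF μF - γ • P.estV x yg μg := by
  have hp := mem_dom hx hyF
  have hQ := hasGradientAt_add_const_mul (A.f_diff _ hp) (A.g_diff _ hp) γ
  have h1 : gradX (P.penalized γ).g x yF = gradX P.f x yF + γ • gradX P.g x yF := by
    refine ext_inner_right ℝ fun d => ?_
    rw [inner_gradX hQ.differentiableAt, inner_add_left, real_inner_smul_left,
      inner_gradX (A.f_diff _ hp), inner_gradX (A.g_diff _ hp)]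
    rw [← inner_gradient_left, ← inner_gradient_left, ← inner_gradient_left]
    erw [hQ.gradient]
    rw [inner_add_left, real_inner_smul_left]
  have h2 : (P.penalized γ).estV x yF μF =
      gradX (P.penalized γ).g x yF + P.gradXgc x yF μF := rfl
  rw [h2, h1, estF]
  module

theorem hasGradientWithinAt_F (A : P.Assumptions lf0 lf1 lgx0 lg1 lgc0 lgc1 α) (hα : 0 < α)
    (hγ : 0 ≤ γ) (hγα : lf1 < γ * α) {μg μF : Vec dx → Vec dc} {yg yF : Vec dx → Vec dy}
    {Bg BF : ℝ} (hg : ∀ x ∈ P.X, IsMaxMinSol P.Y (P.Lg x) (μg x) (yg x))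
    (hF : ∀ x ∈ P.X, IsMaxMinSol P.Y (P.LF γ x) (μF x) (yF x))
    (hBg : ∀ x ∈ P.X, ‖μg x‖ ≤ Bg) (hBF : ∀ x ∈ P.X, ‖μF x‖ ≤ BF) {x : Vec dx}
    (hx : x ∈ P.X) (hLg : P.LICQAt x (yg x)) (hLF : P.LICQAt x (yF x)) :
    HasGradientWithinAt (P.F γ) (P.estF γ x (yg x) (μg x) (yF x) (μF x)) P.X x := by
  have h1 := A.hasGradientWithinAt_v hα (fun x hx => A.isSaddle_Lg hα hx (hg x hx)) hBg hx hLg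
  have h2 := (A.penalized hγ).hasGradientWithinAt_v (sub_pos.2 hγα)
    (fun x hx => A.isSaddle_penalized hγ hγα hx (hF x hx)) hBF hx hLF
  rw [A.estF_eq γ hx (hF x hx).2.1]
  have h3 : HasGradientWithinAt (fun x => (P.penalized γ).v x - γ * P.v x)
      ((P.penalized γ).estV x (yF x) (μF x) - γ • P.estV x (yg x) (μg x)) P.X x := by
    rw [hasGradientWithinAt_iff_hasFDerivWithinAt, map_sub, map_smul]
    exact h2.hasFDerivWithinAt.sub (h1.hasFDerivWithinAt.const_mul γ)
  exact h3.congr_of_mem (fun x hx => A.F_eq hγ hγα hx (hF x hx)) hx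

theorem F_eq_f_add (A : P.Assumptions lf0 lf1 lgx0 lg1 lgc0 lgc1 α) (hα : 0 < α)
    (hγ : 0 ≤ γ) (hγα : lf1 < γ * α) {μg μF : Vec dc} {yg yF : Vec dy} {x : Vec dx}
    (hx : x ∈ P.X) (hg : IsMaxMinSol P.Y (P.Lg x) μg yg)
    (hF : IsMaxMinSol P.Y (P.LF γ x) μF yF) :
    P.F γ x = P.f x yF + γ * (P.g x yF - P.g x yg) := by
  rw [A.F_eq hγ hγα hx hF, v_eq (A.isSaddle_Lg hα hx hg),
    v_eq (P := P.penalized γ) (A.isSaddle_penalized hγ hγα hx hF)]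
  simp only [Problem.penalized]
  ring

/-- The lower-level solution is feasible for the penalized problem, where the penalty vanishes. -/
theorem F_le (A : P.Assumptions lf0 lf1 lgx0 lg1 lgc0 lgc1 α) (hα : 0 < α)
    (hγ : 0 ≤ γ) (hγα : lf1 < γ * α) {μg μF : Vec dc} {yg yF : Vec dy} {x : Vec dx}
    (hx : x ∈ P.X) (hg : IsMaxMinSol P.Y (P.Lg x) μg yg)
    (hF : IsMaxMinSol P.Y (P.LF γ x) μF yF) : P.F γ x ≤ P.f x yg := by
  have s := A.isSaddle_penalized hγ hγα hx hF
  have s' := A.isSaddle_Lg hα hx hg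
  have h1 : (P.penalized γ).v x ≤ (P.penalized γ).Lg x μF yg := by
    rw [v_eq_Lg (P := P.penalized γ) s]
    exact s.isMinOn s'.mem
  have h2 := s.inner_nonpos s'.apply_nonpos
  have h3 : (P.penalized γ).Lg x μF yg =
    P.f x yg + γ * P.g x yg + inner ℝ μF (P.gc x yg) := rfl
  rw [A.F_eq hγ hγα hx hF, v_eq s']
  linarith

/-- The penalty reformulation underestimates the bilevel objective by at most `lf0² / (2 lf1)`,
uniformly in `γ`: quadratic growth of `g x` on the feasible set beats the linear change of `f`. -/
theorem le_F (A : P.Assumptions lf0 lf1 lgx0 lg1 lgc0 lgc1 α) (hα : 0 < α) (hlf1 : 0 < lf1)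
    (hγ : 0 ≤ γ) (hγα : lf1 < γ * α) {μg μF : Vec dc} {yg yF : Vec dy} {x : Vec dx}
    (hx : x ∈ P.X) (hg : IsMaxMinSol P.Y (P.Lg x) μg yg)
    (hF : IsMaxMinSol P.Y (P.LF γ x) μF yF) :
    P.f x yg - lf0 ^ 2 / (2 * lf1) ≤ P.F γ x := by
  have s := A.isSaddle_penalized hγ hγα hx hF
  have s' := A.isSaddle_Lg hα hx hg
  have h1 := strongConvexOn_growth (A.strongConvexOn_Lg hx s'.mem_orthant) s'.mem s.mem s'.isMinOn
  rw [Lg, Lg, s'.inner_eq_zero] at h1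
  have h2 := s'.inner_nonpos s.apply_nonpos
  have h3 := A.f_lip.dist_le_mul _ (mem_dom hx s.mem) _ (mem_dom hx s'.mem)
  rw [dist_eq_norm (pt x yF), pt_sub_pt, sub_self, norm_pt_zero_left] at h3
  have h4 : -(lf0 * ‖yF - yg‖) ≤ P.f x yF - P.f x yg := (abs_le.1 h3).1
  rw [A.F_eq_f_add hα hγ hγα hx hg hF]
  set r := ‖yF - yg‖
  have h5 : γ * (α / 2 * r ^ 2) ≤ γ * (P.g x yF - P.g x yg) := by
    gcongr; linarith
  have h6 : (lf1 : ℝ) * r ^ 2 ≤ γ * α * r ^ 2 := by gcongr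
  have hl : (0 : ℝ) < lf1 := hlf1
  have h7 : lf0 * r ≤ lf1 / 2 * r ^ 2 + lf0 ^ 2 / (2 * lf1) := by
    have : (0 : ℝ) ≤ (lf1 * r - lf0) ^ 2 / (2 * lf1) := by positivity
    have e : (lf1 * r - lf0 : ℝ) ^ 2 / (2 * lf1) =
        lf1 / 2 * r ^ 2 + lf0 ^ 2 / (2 * lf1) - lf0 * r := by field_simp; ring
    linarith
  linarith

/-! ### The error of the gradient estimate -/

/-- Error of the estimate of `∇v` along feasible directions. Only in these directions is the
derivative of `gc` bounded by the Lipschitz constant of `gc` on `X × Y`, which may have empty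
interior. -/
theorem abs_inner_estV_sub_le (A : P.Assumptions lf0 lf1 lgx0 lg1 lgc0 lgc1 α) {x x' : Vec dx}
    {y z : Vec dy} (hx : x ∈ P.X) (hx' : x' ∈ P.X) (hy : y ∈ P.Y) (hz : z ∈ P.Y)
    (μ ν : Vec dc) :
    |inner ℝ (P.estV x z ν - P.estV x y μ) (x' - x)| ≤
      ((lg1 + ‖μ‖ * lgc1) * ‖z - y‖ + lgc0 * ‖ν - μ‖) * ‖x' - x‖ := by
  have e : inner ℝ (P.estV x z ν - P.estV x y μ) (x' - x) =
      (P.dLag μ (pt x z) - P.dLag μ (pt x y)) (pt (x' - x) 0) +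
        inner ℝ (ν - μ) (fderiv ℝ (joint P.gc) (pt x z) (pt (x' - x) 0)) := by
    rw [inner_sub_left, A.inner_estV hx hz, A.inner_estV hx hy, inner_sub_left,
      sub_apply, dLag_apply, dLag_apply, dLag_apply]
    ring
  have h1 := (P.dLag μ (pt x z) - P.dLag μ (pt x y)).le_of_opNorm_le
    (A.norm_dLag_sub_le μ (mem_dom hx hz) (mem_dom hx hy)) (pt (x' - x) 0)
  rw [pt_sub_pt, sub_self, norm_pt_zero_left, norm_pt_zero_right, Real.norm_eq_abs] at h1
  have h2 := norm_fderiv_sub_le_of_lipschitzOnWith A.convex_dom A.gc_lip (mem_dom hx hz)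
    (mem_dom hx' hz) (A.gc_diff _ (mem_dom hx hz))
  rw [pt_sub_pt, sub_self, norm_pt_zero_right] at h2
  have h3 := (abs_real_inner_le_norm (ν - μ) _).trans
    (mul_le_mul_of_nonneg_left h2 (norm_nonneg (ν - μ)))
  rw [e]
  refine (abs_add_le _ _).trans ?_
  linarith

/-- Error of the estimate of `∇F_γ` along feasible directions, of order `γ` times the errors of
the inner solutions. The terms without a factor `γ` are absorbed through `lf1 ≤ γ α`. -/
theorem abs_inner_estF_sub_le (A : P.Assumptions lf0 lf1 lgx0 lg1 lgc0 lgc1 α)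
    (hlf1 : 0 < lf1) (hγ : 0 ≤ γ) (hγα : lf1 ≤ γ * α) {x x' : Vec dx} {yg zg yF zF : Vec dy}
    {μg νg μF νF : Vec dc} {Bg β sg sF : ℝ} (hx : x ∈ P.X) (hx' : x' ∈ P.X) (hyg : yg ∈ P.Y)
    (hzg : zg ∈ P.Y) (hyF : yF ∈ P.Y) (hzF : zF ∈ P.Y) (hμg : ‖μg‖ ≤ Bg) (hμF : ‖μF‖ ≤ β * γ)
    (hyg' : ‖zg - yg‖ ≤ sg) (hμg' : ‖νg - μg‖ ≤ sg) (hyF' : ‖zF - yF‖ ≤ sF)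
    (hμF' : ‖νF - μF‖ ≤ sF) :
    |inner ℝ (P.estF γ x zg νg zF νF - P.estF γ x yg μg yF μF) (x' - x)| ≤
      γ * ((α + lg1 + β * lgc1 + lgc0 * α / lf1) * sF + (lg1 + Bg * lgc1 + lgc0) * sg) *
        ‖x' - x‖ := by
  have e : inner ℝ (P.estF γ x zg νg zF νF - P.estF γ x yg μg yF μF) (x' - x) =
      inner ℝ ((P.penalized γ).estV x zF νF - (P.penalized γ).estV x yF μF) (x' - x) -
        γ * inner ℝ (P.estV x zg νg - P.estV x yg μg) (x' - x) := by
    rw [A.estF_eq γ hx hzF, A.estF_eq γ hx hyF, ← real_inner_smul_left, ← inner_sub_left]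
    congr 1
    module
  have h1 := (A.penalized hγ).abs_inner_estV_sub_le hx hx' hyF hzF μF νF
  have h2 := A.abs_inner_estV_sub_le hx hx' hyg hzg μg νg
  rw [NNReal.coe_add, NNReal.coe_mul, Real.coe_toNNReal _ hγ] at h1
  have hl : (0 : ℝ) < lf1 := hlf1
  have hsF : 0 ≤ sF := (norm_nonneg _).trans hyF'
  have hsg : 0 ≤ sg := (norm_nonneg _).trans hyg'
  have h3 : (lf1 + γ * lg1 + ‖μF‖ * lgc1) * ‖zF - yF‖ + lgc0 * ‖νF - μF‖ ≤
      γ * ((α + lg1 + β * lgc1 + lgc0 * α / lf1) * sF) := by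
    have hc : (lgc0 : ℝ) ≤ γ * (lgc0 * α / lf1) := by
      rw [mul_div_assoc', le_div_iff₀ hl]
      nlinarith [lgc0.coe_nonneg]
    calc (lf1 + γ * lg1 + ‖μF‖ * lgc1) * ‖zF - yF‖ + lgc0 * ‖νF - μF‖
        ≤ (lf1 + γ * lg1 + ‖μF‖ * lgc1) * sF + lgc0 * sF := by gcongr
      _ ≤ (γ * α + γ * lg1 + β * γ * lgc1) * sF + γ * (lgc0 * α / lf1) * sF := by gcongr
      _ = _ := by ring
  have h4 : (lg1 + ‖μg‖ * lgc1) * ‖zg - yg‖ + lgc0 * ‖νg - μg‖ ≤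
      (lg1 + Bg * lgc1 + lgc0) * sg := by
    calc (lg1 + ‖μg‖ * lgc1) * ‖zg - yg‖ + lgc0 * ‖νg - μg‖
        ≤ (lg1 + ‖μg‖ * lgc1) * sg + lgc0 * sg := by gcongr
      _ ≤ (lg1 + Bg * lgc1) * sg + lgc0 * sg := by gcongr
      _ = _ := by ring
  rw [e]
  refine (abs_sub _ _).trans ?_
  rw [abs_mul, abs_of_nonneg hγ]
  calc _ ≤ γ * ((α + lg1 + β * lgc1 + lgc0 * α / lf1) * sF) * ‖x' - x‖ +
        γ * ((lg1 + Bg * lgc1 + lgc0) * sg * ‖x' - x‖) :=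
      add_le_add (h1.trans (by gcongr)) (mul_le_mul_of_nonneg_left (h2.trans (by gcongr)) hγ)
    _ = _ := by ring

end Assumptions

theorem IsRun.mem_X {γ η : ℝ} {T : ℕ} {x : ℕ → Vec dx} {yg yF : ℕ → Vec dy}
    {μg μF : ℕ → Vec dc} (h : P.IsRun γ η T x yg μg yF μF) : ∀ t ≤ T, x t ∈ P.X
  | 0, _ => h.init
  | t + 1, ht => (h.step t ht).1

end Problem

/-! ### Inexact projected gradient descent -/

/-- Projected gradient descent with stepsize at most `1 / l` and gradient errors at most `E` along
the steps. -/
theorem avgSqProjGrad_le {n : ℕ} {X : Set (Vec n)} (hX : Convex ℝ X) {Φ : Vec n → ℝ}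
    {G : Vec n → Vec n} {l : ℝ≥0} (hΦ : ∀ x ∈ X, HasGradientWithinAt Φ (G x) X x)
    (hG : LipschitzOnWith l G X) {η E : ℝ} (hη : 0 < η) (hηl : η * l ≤ 1) {T : ℕ} (hT : 0 < T)
    {x e : ℕ → Vec n} (hx : ∀ t ≤ T, x t ∈ X)
    (hstep : ∀ t < T, IsProj X (x t - η • e t) (x (t + 1)))
    (herr : ∀ t < T, |inner ℝ (e t - G (x t)) (x (t + 1) - x t)| ≤ E * ‖x (t + 1) - x t‖) :
    avgSqProjGrad η T x ≤ 4 / (η * T) * (Φ (x 0) - Φ (x T)) + 4 * E ^ 2 := by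
  have hT' : (0 : ℝ) < T := by exact_mod_cast hT
  have key : ∀ t ∈ Finset.range T, ‖η⁻¹ • (x (t + 1) - x t)‖ ^ 2 ≤
      4 / η * (Φ (x t) - Φ (x (t + 1))) + 4 * E ^ 2 := by
    intro t ht
    rw [Finset.mem_range] at ht
    have hxt := hx t ht.le
    have h1 := le_quadratic_of_lipschitz_gradient hX hΦ hG hxt (hx (t + 1) ht)
    have h2 := (hstep t ht).inner_nonpos hX hxt
    have h3 := (abs_le.1 (herr t ht)).1
    set d := x (t + 1) - x t with hd
    have e1 : x t - η • e t - x (t + 1) = -(d + η • e t) := by rw [hd]; abel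
    have e2 : x t - x (t + 1) = -d := by rw [hd]; abel
    rw [e1, e2, inner_neg_neg, inner_add_left, real_inner_self_eq_norm_sq,
      real_inner_smul_left] at h2
    rw [inner_sub_left] at h3
    rw [norm_smul, norm_inv, Real.norm_of_nonneg hη.le, mul_pow]
    have h4 : η * l * ‖d‖ ^ 2 ≤ 1 * ‖d‖ ^ 2 := by gcongr
    -- Young's inequality for the error term `η * E * ‖d‖`
    have h5 : 0 ≤ (2 * η * E - ‖d‖) ^ 2 := sq_nonneg _
    have h6 := mul_le_mul_of_nonneg_left h1 hη.le
    have h7 := mul_le_mul_of_nonneg_left h3 hη.le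
    have e3 : 4 / η * (Φ (x t) - Φ (x (t + 1))) + 4 * E ^ 2 =
        (4 * η * (Φ (x t) - Φ (x (t + 1))) + 4 * η ^ 2 * E ^ 2) / η ^ 2 := by
      field_simp
    have e4 : η⁻¹ ^ 2 * ‖d‖ ^ 2 = ‖d‖ ^ 2 / η ^ 2 := by field_simp
    rw [e3, e4]
    gcongr
    linarith
  have hsum := Finset.sum_le_sum key
  rw [Finset.sum_add_distrib, ← Finset.mul_sum, Finset.sum_range_sub', Finset.sum_const,
    Finset.card_range, nsmul_eq_mul] at hsum
  refine (mul_le_mul_of_nonneg_left hsum (by positivity)).trans_eq ?_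
  field_simp

/-! ### Convergence -/

theorem le_sqrt_of_sq_add_sq_le {a b K ε : ℝ} (hε : 0 < ε) (h : a ^ 2 + b ^ 2 ≤ K * ε) :
    a ≤ √(|K| * ε) ∧ b ≤ √(|K| * ε) := by
  have hK : K * ε ≤ |K| * ε := mul_le_mul_of_nonneg_right (le_abs_self K) hε.le
  exact ⟨Real.le_sqrt_of_sq_le (by nlinarith [sq_nonneg b]),
    Real.le_sqrt_of_sq_le (by nlinarith [sq_nonneg a])⟩

end BLOCC

theorem theorem2
    -- Lipschitz, convexity and multiplier constants
    (lf0 lf1 lgx0 lg1 lgc0 lgc1 : ℝ≥0) (αg Bg β : ℝ) (hlf1 : 0 < lf1) (hαg : 0 < αg)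
    -- implied constants of the inner accuracies, and a bound on the initial optimality gap
    (Kg KF Δ : ℝ) :
    ∃ C : ℝ, 0 < C ∧
      ∀ (dx dy dc : ℕ) (P : BLOCC.Problem dx dy dc),
        P.Assumptions lf0 lf1 lgx0 lg1 lgc0 lgc1 αg →
      ∀ (γ : ℝ), (lf1 : ℝ) / αg < γ →
      -- the max-min solutions of the lower-level and of the penalized problem
      ∀ (yg yF : BLOCC.Vec dx → BLOCC.Vec dy) (μg μF : BLOCC.Vec dx → BLOCC.Vec dc),
        (∀ x ∈ P.X, BLOCC.IsMaxMinSol P.Y (P.Lg x) (μg x) (yg x)) →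
        (∀ x ∈ P.X, BLOCC.IsMaxMinSol P.Y (P.LF γ x) (μF x) (yF x)) →
        (∀ x ∈ P.X, P.LICQAt x (yg x) ∧ P.LICQAt x (yF x)) →
        (∀ x ∈ P.X, ‖μg x‖ < Bg) →
      ∀ (BF : ℝ), (∀ x ∈ P.X, ‖μF x‖ < BF) → BF ≤ β * γ →
      -- `lF1` is a Lipschitz constant on `X` of the gradient of `F γ` in closed form
      ∀ (lF1 : ℝ≥0),
        LipschitzOnWith lF1 (fun x => P.estF γ x (yg x) (μg x) (yF x) (μF x)) P.X →
      (∀ x ∈ P.X,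
        HasGradientWithinAt (P.F γ) (P.estF γ x (yg x) (μg x) (yF x) (μF x)) P.X x) ∧
      ∀ (η εg εF : ℝ) (T : ℕ), 0 < η → η * lF1 ≤ 1 → 0 < εg → 0 < εF → 0 < T →
      ∀ (xs : ℕ → BLOCC.Vec dx) (ygs yFs : ℕ → BLOCC.Vec dy) (μgs μFs : ℕ → BLOCC.Vec dc),
        P.IsRun γ η T xs ygs μgs yFs μFs →
        -- finite optimal value of the bilevel problem
        (∀ x ∈ P.X, P.f (xs 0) (yg (xs 0)) - P.f x (yg x) ≤ Δ) →
        (∀ t < T, ‖ygs t - yg (xs t)‖ ^ 2 + ‖μgs t - μg (xs t)‖ ^ 2 ≤ Kg * εg) →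
        (∀ t < T, ‖yFs t - yF (xs t)‖ ^ 2 + ‖μFs t - μF (xs t)‖ ^ 2 ≤ KF * εF) →
        BLOCC.avgSqProjGrad η T xs ≤ C * (1 / (η * T) + γ ^ 2 * εF + γ ^ 2 * εg) ∧
        -- in particular the rate `γ / T` for stepsizes of order `1 / γ`
        ∀ c : ℝ, 0 < c → c / γ ≤ η →
          BLOCC.avgSqProjGrad η T xs ≤ C * (γ / (c * T) + γ ^ 2 * εF + γ ^ 2 * εg) := by
  have hl : (0 : ℝ) < lf1 := hlf1
  -- `MF` and `Mg` bound the error of the gradient estimate per unit of inner error and of `γ`;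
  -- the absolute values make `C` positive whatever the signs of `Bg`, `β`, `Kg`, `KF` and `Δ`
  set MF : ℝ := αg + lg1 + |β| * lgc1 + lgc0 * αg / lf1 with hMF
  set Mg : ℝ := lg1 + |Bg| * lgc1 + lgc0 with hMg
  have hMF0 : 0 ≤ MF := by positivity
  have hMg0 : 0 ≤ Mg := by positivity
  set C₁ : ℝ := 4 * (|Δ| + lf0 ^ 2 / (2 * lf1)) with hC₁
  set CF : ℝ := 8 * MF ^ 2 * |KF| with hCF
  set Cg : ℝ := 8 * Mg ^ 2 * |Kg| with hCg
  have hC₁0 : 0 ≤ C₁ := by positivity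
  have hCF0 : 0 ≤ CF := by positivity
  have hCg0 : 0 ≤ Cg := by positivity
  refine ⟨C₁ + CF + Cg + 1, by positivity, ?_⟩
  intro dx dy dc P A γ hγ yg yF μg μF hg hF hLICQ hBg BF hBF hβ lF1 hlF1
  -- `γ > lf1 / αg` makes `f x + γ * g x` strongly convex with the positive parameter `γ αg - lf1`
  have hγ0 : 0 < γ := lt_of_le_of_lt (by positivity) hγ
  have hγα : lf1 < γ * αg := (div_lt_iff₀ hαg).1 hγ
  have hgrad : ∀ x ∈ P.X,
      HasGradientWithinAt (P.F γ) (P.estF γ x (yg x) (μg x) (yF x) (μF x)) P.X x := fun x hx =>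
    A.hasGradientWithinAt_F hαg hγ0.le hγα hg hF (fun x hx => (hBg x hx).le)
      (fun x hx => (hBF x hx).le) hx (hLICQ x hx).1 (hLICQ x hx).2
  refine ⟨hgrad, ?_⟩
  intro η εg εF T hη hηl hεg hεF hT xs ygs yFs μgs μFs hrun hΔ herrg herrF
  have hT' : (0 : ℝ) < T := by exact_mod_cast hT
  have hmem := hrun.mem_X
  set sF := √(|KF| * εF) with hsF
  set sg := √(|Kg| * εg) with hsg
  have main := BLOCC.avgSqProjGrad_le A.X_convex hgrad hlF1 hη hηl hT hmem hrun.step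
    (E := γ * (MF * sF + Mg * sg)) (fun t ht => by
      have hx := hmem t ht.le
      obtain ⟨h1, h2⟩ := BLOCC.le_sqrt_of_sq_add_sq_le hεg (herrg t ht)
      obtain ⟨h3, h4⟩ := BLOCC.le_sqrt_of_sq_add_sq_le hεF (herrF t ht)
      exact A.abs_inner_estF_sub_le hlf1 hγ0.le hγα.le hx (hmem (t + 1) ht) (hg _ hx).2.1
        (hrun.yg_mem t ht) (hF _ hx).2.1 (hrun.yF_mem t ht)
        ((hBg _ hx).le.trans (le_abs_self Bg))
        (((hBF _ hx).le.trans hβ).trans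
          (mul_le_mul_of_nonneg_right (le_abs_self β) hγ0.le)) h1 h2 h3 h4)
  have hx0 := hmem 0 hT.le
  have hxT := hmem T le_rfl
  have hgap : 4 * (P.F γ (xs 0) - P.F γ (xs T)) ≤ C₁ := by
    have h1 := A.F_le hαg hγ0.le hγα hx0 (hg _ hx0) (hF _ hx0)
    have h2 := A.le_F hαg hlf1 hγ0.le hγα hxT (hg _ hxT) (hF _ hxT)
    have h3 := hΔ _ hxT
    have h4 := le_abs_self Δ
    linarith
  have hE : 4 * (γ * (MF * sF + Mg * sg)) ^ 2 ≤ γ ^ 2 * (CF * εF + Cg * εg) := by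
    have h1 : sF ^ 2 = |KF| * εF := Real.sq_sqrt (by positivity)
    have h2 : sg ^ 2 = |Kg| * εg := Real.sq_sqrt (by positivity)
    have h3 : (MF * sF + Mg * sg) ^ 2 ≤ 2 * (MF ^ 2 * sF ^ 2 + Mg ^ 2 * sg ^ 2) :=
      add_sq_le.trans_eq (by ring)
    rw [h1, h2] at h3
    calc 4 * (γ * (MF * sF + Mg * sg)) ^ 2 = 4 * γ ^ 2 * (MF * sF + Mg * sg) ^ 2 := by ring
      _ ≤ 4 * γ ^ 2 * (2 * (MF ^ 2 * (|KF| * εF) + Mg ^ 2 * (|Kg| * εg))) := by gcongr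
      _ = _ := by ring
  have bound : BLOCC.avgSqProjGrad η T xs ≤
      (C₁ + CF + Cg + 1) * (1 / (η * T) + γ ^ 2 * εF + γ ^ 2 * εg) := by
    have h1 : 4 / (η * T) * (P.F γ (xs 0) - P.F γ (xs T)) ≤ C₁ * (1 / (η * T)) := by
      rw [div_mul_eq_mul_div, mul_one_div]
      gcongr
    calc _ ≤ C₁ * (1 / (η * T)) + γ ^ 2 * (CF * εF + Cg * εg) := main.trans (add_le_add h1 hE)
      _ = C₁ * (1 / (η * T)) + CF * (γ ^ 2 * εF) + Cg * (γ ^ 2 * εg) := by ring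
      _ ≤ (C₁ + CF + Cg + 1) * (1 / (η * T)) + (C₁ + CF + Cg + 1) * (γ ^ 2 * εF) +
          (C₁ + CF + Cg + 1) * (γ ^ 2 * εg) := by gcongr <;> linarith
      _ = _ := by ring
  refine ⟨bound, fun c hc hcη => bound.trans ?_⟩
  have h1 : 1 / (η * T) ≤ γ / (c * T) := by
    rw [div_le_iff₀ hγ0] at hcη
    rw [div_le_div_iff₀ (by positivity) (by positivity)]
    linarith [mul_le_mul_of_nonneg_right hcη hT'.le]
  gcongr

end
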